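/- Let $n\ge 2$ be an integer and let $p\in(2,\infty)$. There is a smooth complete (connected, non-compact, boundaryless) $n$-dimensional Riemannian manifold $(M,g)$ on which the $L^p$ gradient estimate fails, i.e. there is no constant $C$ such that $$\big\||\nabla u|\big\|_{L^p(M)}\le C\big(\|u\|_{L^p(M)}+\|\Delta u\|_{L^p(M)}\big)\qquad\text{for all }u\in C_c^\infty(M),$$ where $\nabla$, $\Delta$ and the $L^p$ norms are the Riemannian gradient, the Laplace--Beltrami operator and the norms with respect to the Riemannian volume of $g$. More precisely, there are a function $\lambda\in C^\infty(\mathbb R^2)$ with $0<\lambda\le 1$ and $\lambda=1$ outside $\bigcup_{m=0}^{\infty}B_{1/8}((m,0))$, a connected closed Riemannian manifold $(N,h)$ of dimension $n-2$ (a single point if $n=2$), and functions $u_k\in C_c^\infty(\mathbb R^2)$, $k=0,1,2,\dots$, such that $(M,g)=(\mathbb R^2\times N,\ \lambda^2dx^2+h)$ is complete, the $L^p$ gradient estimate fails on $(M,g)$, and the functions $v_k(x,y)=u_k(x)$ on $M$ satisfy $$\sup_k\|v_k\|_{L^p(M)}<\infty,\qquad \sup_k\|\Delta v_k\|_{L^p(M)}<\infty,\qquad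 \sup_k\big\||\nabla v_k|\big\|_{L^p(M)}=\infty .$$ -/

import Mathlib

open Set Filter Topology MeasureTheory Manifold Bundle
open scoped NNReal ENNReal ContDiff Matrix

noncomputable section

namespace RiemannianLp

/-! ### Riemannian geometry in local coordinates

Throughout, `M` is a smooth manifold without boundary modelled on the finite-dimensional real vector
space `E`, and `g` is a smooth Riemannian metric on `M`.  A basis `b` of `E` turns every chart into
a local coordinate system `(y₁, …, y_d)` of `M`.  The gradient, the Laplacian and the volume defined
below are the usual ones; they depend neither on the basis nor on the charts that are used to write
them down. -/

variable {E : Type*} [NormedAddCommGroup E] [NormedSpace ℝ E]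
  {H : Type*} [TopologicalSpace H] {I : ModelWithCorners ℝ E H}
  {M : Type*} [TopologicalSpace M] [ChartedSpace H M] [IsManifold I ∞ M]
  {ι : Type*} [Fintype ι] [DecidableEq ι]

/-- The coordinate vector field `∂ᵢ` of the chart around `x`, at the point with coordinates `y`. -/
def coordVec (I : ModelWithCorners ℝ E H) (b : Module.Basis ι ℝ E) (x : M) (y : E) (i : ι) :
    TangentSpace I ((extChartAt I x).symm y) :=
  mfderiv 𝓘(ℝ, E) I (extChartAt I x).symm y (b i)

/-- The matrix `(g_ij) = (g(∂ᵢ, ∂ⱼ))` of the metric in the chart around `x`, at the point with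
coordinates `y`. -/
def gram (g : ContMDiffRiemannianMetric I ∞ E (fun z : M => TangentSpace I z))
    (b : Module.Basis ι ℝ E) (x : M) (y : E) : Matrix ι ι ℝ :=
  Matrix.of fun i j =>
    g.inner ((extChartAt I x).symm y) (coordVec I b x y i) (coordVec I b x y j)

/-- The Riemannian volume density `√det (g_ij)` in the chart around `x`. -/
def volDensity (g : ContMDiffRiemannianMetric I ∞ E (fun z : M => TangentSpace I z))
    (b : Module.Basis ι ℝ E) (x : M) (y : E) : ℝ :=
  √(gram g b x y).det

/-- The components `(∇u)ⁱ = ∑ⱼ gⁱʲ ∂ⱼu` of the Riemannian gradient in the chart around `x`. -/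
def coordGrad (g : ContMDiffRiemannianMetric I ∞ E (fun z : M => TangentSpace I z))
    (b : Module.Basis ι ℝ E) (u : M → ℝ) (x : M) (y : E) : ι → ℝ :=
  (gram g b x y)⁻¹ *ᵥ fun j => fderiv ℝ (u ∘ (extChartAt I x).symm) y (b j)

/-- The length `|∇u|(x)` of the Riemannian gradient, `|∇u|² = ∑ᵢⱼ g_ij (∇u)ⁱ (∇u)ʲ`. -/
def gradNorm (g : ContMDiffRiemannianMetric I ∞ E (fun z : M => TangentSpace I z))
    (b : Module.Basis ι ℝ E) (u : M → ℝ) (x : M) : ℝ :=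
  √(coordGrad g b u x (extChartAt I x x) ⬝ᵥ
      (gram g b x (extChartAt I x x) *ᵥ coordGrad g b u x (extChartAt I x x)))

/-- The Laplace–Beltrami operator
`Δu = div ∇u = (√det g)⁻¹ ∑ᵢ ∂ᵢ (√det g (∇u)ⁱ)`, evaluated in the chart around `x`. -/
def laplacian (g : ContMDiffRiemannianMetric I ∞ E (fun z : M => TangentSpace I z))
    (b : Module.Basis ι ℝ E) (u : M → ℝ) (x : M) : ℝ :=
  (volDensity g b x (extChartAt I x x))⁻¹ *
    ∑ i, fderiv ℝ (fun y => volDensity g b x y * coordGrad g b u x y i) (extChartAt I x x) (b i)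

/-- The Riemannian volume measure on the domain of the chart around `x` (and zero outside of it):
the measure `√det (g_ij) dy₁ ⋯ dy_d` transported to `M`. -/
def chartVolume [MeasurableSpace E] [BorelSpace E] [MeasurableSpace M]
    (g : ContMDiffRiemannianMetric I ∞ E (fun z : M => TangentSpace I z))
    (b : Module.Basis ι ℝ E) (x : M) : Measure M :=
  ((b.addHaar.restrict (extChartAt I x).target).withDensity
    fun y => ENNReal.ofReal (volDensity g b x y)).map (extChartAt I x).symm

/-- The Riemannian volume measure of a second countable manifold.  The measures `chartVolume g b x`
agree on the overlaps of the chart domains, and their supremum is the measure on `M` that restricts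
to each of them. -/
def volumeMeasure [MeasurableSpace E] [BorelSpace E] [MeasurableSpace M]
    (g : ContMDiffRiemannianMetric I ∞ E (fun z : M => TangentSpace I z))
    (b : Module.Basis ι ℝ E) : Measure M :=
  ⨆ x : M, chartVolume g b x

/-- The Riemannian distance of `g`: the infimum of the lengths of the `C¹` paths between two
points. -/
def rdist (g : ContMDiffRiemannianMetric I ∞ E (fun z : M => TangentSpace I z)) (x y : M) :
    ℝ≥0∞ :=
  letI : RiemannianBundle (fun z : M => TangentSpace I z) := ⟨g.toRiemannianMetric⟩
  riemannianEDist I x y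

/-- `(M, g)` is complete: sequences that are Cauchy for the Riemannian distance converge. -/
def IsComplete (g : ContMDiffRiemannianMetric I ∞ E (fun z : M => TangentSpace I z)) : Prop :=
  ∀ s : ℕ → M,
    (∀ ε : ℝ≥0∞, 0 < ε → ∃ K, ∀ j ≥ K, ∀ k ≥ K, rdist g (s j) (s k) < ε) →
      ∃ x, Tendsto s atTop (𝓝 x)

/-- The `Lᵖ` norm of a function on `(M, g)`, with respect to the Riemannian volume. -/
def lpNorm [MeasurableSpace E] [BorelSpace E] [MeasurableSpace M]
    (g : ContMDiffRiemannianMetric I ∞ E (fun z : M => TangentSpace I z))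
    (b : Module.Basis ι ℝ E) (p : ℝ) (f : M → ℝ) : ℝ≥0∞ :=
  eLpNorm f (ENNReal.ofReal p) (volumeMeasure g b)

/-- The `Lᵖ` gradient estimate on `(M, g)`: for some constant `C`,
`‖|∇u|‖_p ≤ C (‖u‖_p + ‖Δu‖_p)` for all smooth compactly supported functions `u`. -/
def GradientEstimate [MeasurableSpace E] [BorelSpace E] [MeasurableSpace M]
    (g : ContMDiffRiemannianMetric I ∞ E (fun z : M => TangentSpace I z))
    (b : Module.Basis ι ℝ E) (p : ℝ) : Prop :=
  ∃ C : ℝ≥0, ∀ u : M → ℝ, ContMDiff I 𝓘(ℝ, ℝ) ∞ u → HasCompactSupport u →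
    lpNorm g b p (gradNorm g b u) ≤ C * (lpNorm g b p u + lpNorm g b p (laplacian g b u))

/-- The `d`-dimensional Euclidean space. -/
abbrev Euc (d : ℕ) : Type := EuclideanSpace ℝ (Fin d)

/-- The standard basis of `ℝ² × ℝᵈ`, the model space of the product of the plane with a
`d`-dimensional manifold. -/
def stdBasis (d : ℕ) : Module.Basis (Fin 2 ⊕ Fin d) ℝ (Euc 2 × Euc d) :=
  (EuclideanSpace.basisFun (Fin 2) ℝ).toBasis.prod (EuclideanSpace.basisFun (Fin d) ℝ).toBasis

/-- `g` is the product, on `ℝ² × N`, of the conformally flat metric `lam² dx²` on the plane with the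
metric `h` on `N`. -/
def IsConformalProduct {d : ℕ} {N : Type} [TopologicalSpace N] [ChartedSpace (Euc d) N]
    [IsManifold (𝓡 d) ∞ N] (lam : Euc 2 → ℝ)
    (h : ContMDiffRiemannianMetric (𝓡 d) ∞ (Euc d) (fun y : N => TangentSpace (𝓡 d) y))
    (g : ContMDiffRiemannianMetric ((𝓡 2).prod (𝓡 d)) ∞ (Euc 2 × Euc d)
      (fun z : Euc 2 × N => TangentSpace ((𝓡 2).prod (𝓡 d)) z)) : Prop :=
  ∀ (x : Euc 2) (y : N) (v₁ w₁ : Euc 2) (v₂ w₂ : Euc d),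
    g.inner (x, y) ((v₁, v₂) : Euc 2 × Euc d) ((w₁, w₂) : Euc 2 × Euc d) =
      lam x ^ 2 * inner ℝ v₁ w₁ + h.inner y v₂ w₂

end RiemannianLp

end

/-! In dimension two the metric `lam² dx²` has volume `lam² dx`, gradient length `lam⁻¹ |∇u|` and
Laplacian `lam⁻² Δu`. Hence `∫ |∇u|^p dvol = ∫ lam^(2-p) |∇u|^p dx`, which grows without bound for
`p > 2` when `lam` becomes small where `∇u` does not vanish. The Laplacian does not notice this if
`u` is harmonic wherever `lam ≠ 1`.

Accordingly `conformalFactor` is of size `1/k` on the ball of radius `1/40` around `(k, 0)`, and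
`testFunction k` is a translate of one fixed cut-off linear coordinate, linear near `(k, 0)` and
vanishing near the other spikes. By `planeLaplacian_testFunction_eq_zero_or` the functions and their
Laplacians are translates of fixed functions, and `lam ≤ 1` bounds their norms uniformly. On the
small ball the gradient is at least `k/2` and the volume at least a constant times `k⁻²`, so the
gradient norms grow at least like `k^(1-2/p)`.

A flat torus factor raises the dimension and leaves these computations unchanged. Its transition
maps are translations, so tangent vectors have chart-independent components and the Gram matrix is
diagonal in every preferred chart. The volume measure is only bounded above by a product measure and
below by one chart.

For completeness, the functions `staircase (x i)` are constant across the spikes and 1-Lipschitz for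
the Riemannian distance, yet grow linearly. Cauchy sequences therefore stay in a compact set. -/

noncomputable section

namespace RiemannianLp

section

/-! ### Manifolds whose transition maps are translations -/

section Translation

variable {E : Type*} [NormedAddCommGroup E] [NormedSpace ℝ E]
  {H : Type*} [TopologicalSpace H] {I : ModelWithCorners ℝ E H}
  {M : Type*} [TopologicalSpace M] [ChartedSpace H M]

/-- The transition maps between the preferred charts of `M` are locally translations. -/
def HasTranslationCharts (I : ModelWithCorners ℝ E H) (M : Type*) [TopologicalSpace M]
    [ChartedSpace H M] : Prop :=
  ∀ x x' z : M, z ∈ (extChartAt I x).source → z ∈ (extChartAt I x').source →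
    ∃ c : E, ∀ᶠ w in 𝓝 (extChartAt I x z), extChartAt I x' ((extChartAt I x).symm w) = w + c

theorem HasTranslationCharts.hasFDerivAt (hM : HasTranslationCharts I M) {x x' z : M}
    (hz : z ∈ (extChartAt I x).source) (hz' : z ∈ (extChartAt I x').source) :
    HasFDerivAt (extChartAt I x' ∘ (extChartAt I x).symm) (ContinuousLinearMap.id ℝ E)
      (extChartAt I x z) := by
  obtain ⟨c, hc⟩ := hM x x' z hz hz'
  exact ((hasFDerivAt_id _).add_const c).congr_of_eventuallyEq hc

theorem hasTranslationCharts_modelSpace (F : Type*) [NormedAddCommGroup F] [NormedSpace ℝ F] :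
    HasTranslationCharts 𝓘(ℝ, F) F :=
  fun x x' z _ _ => ⟨0, Eventually.of_forall fun w => by simp [chartAt_self_eq]⟩

theorem HasTranslationCharts.prod {E' : Type*} [NormedAddCommGroup E'] [NormedSpace ℝ E']
    {H' : Type*} [TopologicalSpace H'] {I' : ModelWithCorners ℝ E' H'}
    {M' : Type*} [TopologicalSpace M'] [ChartedSpace H' M']
    (hM : HasTranslationCharts I M) (hM' : HasTranslationCharts I' M') :
    HasTranslationCharts (I.prod I') (M × M') := by
  intro x x' z hz hz'
  rw [extChartAt_prod, PartialEquiv.prod_source] at hz hz'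
  obtain ⟨c, hc⟩ := hM x.1 x'.1 z.1 hz.1 hz'.1
  obtain ⟨c', hc'⟩ := hM' x.2 x'.2 z.2 hz.2 hz'.2
  refine ⟨(c, c'), ?_⟩
  rw [extChartAt_prod, extChartAt_prod]
  filter_upwards [(Filter.Eventually.prod_nhds (x := extChartAt I x.1 z.1) hc hc' :)] with w hw
  exact Prod.ext hw.1 hw.2

variable [IsManifold I 1 M]

/-- Coordinate changes of the tangent bundle are derivatives of transition maps, and a translation
has derivative the identity. This is what lets constant vectors of `E` serve as global vector
fields. -/
theorem HasTranslationCharts.coordChange_eq_id (hM : HasTranslationCharts I M) {x x' z : M}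
    (hz : z ∈ (chartAt H x).source) (hz' : z ∈ (chartAt H x').source) :
    (tangentBundleCore I M).coordChange (achart H x) (achart H x') z =
      ContinuousLinearMap.id ℝ E := by
  rw [tangentBundleCore_coordChange_achart]
  refine (hM.hasFDerivAt ?_ ?_).hasFDerivWithinAt.fderivWithin
    (I.uniqueDiffOn.uniqueDiffWithinAt ?_)
  · rwa [extChartAt_source]
  · rwa [extChartAt_source]
  · exact extChartAt_target_subset_range x ((extChartAt I x).map_source (by rwa [extChartAt_source]))

end Translation

/-! ### The flat torus -/

/-- The torus `ℝᵈ / ℤᵈ`. -/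
def FlatTorus (d : ℕ) : Type := UnitAddTorus (Fin d)

namespace FlatTorus

variable {d : ℕ}

instance : TopologicalSpace (FlatTorus d) := inferInstanceAs (TopologicalSpace (UnitAddTorus (Fin d)))
instance : MeasureSpace (FlatTorus d) := inferInstanceAs (MeasureSpace (Fin d → UnitAddCircle))
instance : BorelSpace (FlatTorus d) := inferInstanceAs (BorelSpace (Fin d → UnitAddCircle))
instance : T2Space (FlatTorus d) := inferInstanceAs (T2Space (Fin d → UnitAddCircle))
instance : CompactSpace (FlatTorus d) := inferInstanceAs (CompactSpace (Fin d → UnitAddCircle))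
instance : ConnectedSpace (FlatTorus d) := inferInstanceAs (ConnectedSpace (Fin d → UnitAddCircle))
instance : SecondCountableTopology (FlatTorus d) :=
  inferInstanceAs (SecondCountableTopology (Fin d → UnitAddCircle))
instance : IsProbabilityMeasure (volume : Measure (FlatTorus d)) :=
  haveI : IsProbabilityMeasure (volume : Measure UnitAddCircle) := ⟨UnitAddCircle.measure_univ⟩
  inferInstanceAs (IsProbabilityMeasure (Measure.pi fun _ : Fin d => (volume : Measure UnitAddCircle)))

/-- The local inverse of the covering map `ℝᵈ → ℝᵈ / ℤᵈ` with values in the open unit cube whose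
smallest corner is `a`. -/
def chart (a : Fin d → ℝ) : OpenPartialHomeomorph (FlatTorus d) (Euc d) :=
  (OpenPartialHomeomorph.pi fun i =>
    (AddCircle.openPartialHomeomorphCoe (1 : ℝ) (a i)).symm).transHomeomorph
      (EuclideanSpace.equiv (Fin d) ℝ).symm.toHomeomorph

/-- The covering map `ℝᵈ → ℝᵈ / ℤᵈ`. -/
def mk (w : Euc d) : FlatTorus d := fun i => (w i : UnitAddCircle)

theorem chart_symm_apply (a : Fin d → ℝ) (w : Euc d) : (chart a).symm w = mk w := rfl

theorem chart_source (a : Fin d → ℝ) :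
    (chart a).source = Set.pi univ fun i => {(a i : UnitAddCircle)}ᶜ := by
  rfl

theorem chart_target (a : Fin d → ℝ) :
    (chart a).target = {w : Euc d | ∀ i, w i ∈ Ioo (a i) (a i + 1)} := by
  ext w
  simp [chart, Set.mem_pi]

/-- The corner of the unit cube used for the chart around `y`. -/
def corner (y : FlatTorus d) (i : Fin d) : ℝ :=
  Quotient.out (y i + ((1 / 2 : ℝ) : UnitAddCircle))

theorem coe_corner (y : FlatTorus d) (i : Fin d) :
    ((corner y i : ℝ) : UnitAddCircle) = y i + ((1 / 2 : ℝ) : UnitAddCircle) :=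
  Quotient.out_eq _

/-- The corner is shifted from the point by half a period in each coordinate, so the point lies at
the centre of its cube, away from the removed faces. -/
theorem mem_chart_corner_source (y : FlatTorus d) : y ∈ (chart (corner y)).source := by
  rw [chart_source]
  intro i _
  rw [mem_compl_singleton_iff, coe_corner]
  intro h
  have h0 : ((1 / 2 : ℝ) : UnitAddCircle) = 0 := by simpa using h.symm
  rw [AddCircle.coe_eq_zero_iff_of_mem_Ico (by norm_num)] at h0
  norm_num at h0

instance : ChartedSpace (Euc d) (FlatTorus d) where
  atlas := range chart
  chartAt y := chart (corner y)
  mem_chart_source := mem_chart_corner_source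
  chart_mem_atlas _ := mem_range_self _

theorem chart_mk (b : Fin d → ℝ) (w : Euc d) (hw : mk w ∈ (chart b).source) :
    ∀ i, ∃ n : ℤ, chart b (mk w) i - w i = n := by
  have h := (chart b).left_inv hw
  rw [chart_symm_apply] at h
  intro i
  have hi : ((chart b (mk w) i : ℝ) : UnitAddCircle) = (w i : UnitAddCircle) := congrFun h i
  rw [← sub_eq_zero, ← AddCircle.coe_sub, AddCircle.coe_eq_zero_iff] at hi
  obtain ⟨n, hn⟩ := hi
  exact ⟨n, by simpa using hn.symm⟩

theorem continuous_mk : Continuous (mk : Euc d → FlatTorus d) :=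
  continuous_pi fun i => (AddCircle.continuous_mk' 1).comp (by fun_prop)

/-- A chart inverts the covering map, so `chart b (mk w) - w` is an integer vector. Being continuous
near `w₀`, it is locally constant. -/
theorem eventually_chart_mk (b : Fin d → ℝ) (w₀ : Euc d) (hw₀ : mk w₀ ∈ (chart b).source) :
    ∀ᶠ w in 𝓝 w₀, chart b (mk w) = w + (chart b (mk w₀) - w₀) := by
  have hc : ContinuousAt (fun w : Euc d => chart b (mk w) - w) w₀ :=
    (((chart b).continuousAt hw₀).comp continuous_mk.continuousAt).sub continuousAt_id
  have hs : ∀ᶠ w in 𝓝 w₀, mk w ∈ (chart b).source :=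
    continuous_mk.continuousAt.eventually ((chart b).open_source.mem_nhds hw₀)
  have hd : ∀ i, ∀ᶠ w in 𝓝 w₀,
      |(chart b (mk w) i - w i) - (chart b (mk w₀) i - w₀ i)| < 1 := by
    intro i
    have hci : ContinuousAt (fun w : Euc d => (chart b (mk w) - w) i) w₀ :=
      (EuclideanSpace.proj i : Euc d →L[ℝ] ℝ).continuous.continuousAt.comp hc
    simpa [Real.dist_eq, sub_sub_eq_add_sub] using hci.eventually (Metric.ball_mem_nhds _ one_pos)
  filter_upwards [hs, eventually_all.2 hd] with w hw hwd
  ext i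
  obtain ⟨n, hn⟩ := chart_mk b w hw i
  obtain ⟨m, hm⟩ := chart_mk b w₀ hw₀ i
  have h1 := hwd i
  rw [hn, hm, ← Int.cast_sub, ← Int.cast_abs] at h1
  have h2 : |n - m| < 1 := by exact_mod_cast h1
  have h3 : n = m := by rw [Int.abs_lt_one_iff] at h2; omega
  subst h3
  simp only [PiLp.add_apply, PiLp.sub_apply]
  linarith

theorem hasTranslationCharts (d : ℕ) : HasTranslationCharts (𝓡 d) (FlatTorus d) := by
  intro x x' z hz hz'
  rw [extChartAt_source] at hz hz'
  refine ⟨_, eventually_chart_mk (corner x') (chart (corner x) z) ?_⟩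
  rw [← chart_symm_apply (corner x), (chart (corner x)).left_inv hz]
  exact hz'

instance : IsManifold (𝓡 d) ∞ (FlatTorus d) := by
  refine isManifold_of_contDiffOn _ _ _ ?_
  rintro _ _ ⟨a, rfl⟩ ⟨b, rfl⟩ w ⟨hw, -⟩
  refine ContDiffAt.contDiffWithinAt ?_
  have h : mk w ∈ (chart b).source := hw.2
  exact (contDiffAt_id.add contDiffAt_const).congr_of_eventuallyEq (eventually_chart_mk b w h)

/-- On a unit cube, the covering map does not increase the measure of sets. -/
theorem map_mk_restrict_chart_target_le (a : Fin d → ℝ) :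
    (volume.restrict (chart a).target).map mk ≤ (volume : Measure (FlatTorus d)) := by
  have h1 := measurePreserving_pi _ _ (fun i => UnitAddCircle.measurePreserving_mk (a i))
  rw [← Measure.restrict_pi_pi] at h1
  have h2 := (PiLp.volume_preserving_ofLp (Fin d)).restrict_preimage
    (s := Set.pi univ fun i => Ioo (a i) (a i + 1)) (.univ_pi fun i => measurableSet_Ioo)
  have h3 : (chart a).target = WithLp.ofLp ⁻¹' Set.pi univ fun i => Ioo (a i) (a i + 1) := by
    rw [chart_target]
    ext w
    simp [Set.mem_pi]
  let q : (Fin d → ℝ) → FlatTorus d := fun v i => (v i : UnitAddCircle)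
  have hq : Measurable q := h1.measurable
  calc (volume.restrict (chart a).target).map mk
      = ((volume.restrict (chart a).target).map WithLp.ofLp).map q :=
        (Measure.map_map hq h2.measurable).symm
    _ = (volume.restrict (Set.pi univ fun i => Ioo (a i) (a i + 1))).map q := by
        rw [h3, h2.map_eq]
    -- The covering map preserves measure on half-open cubes, whereas the chart target is the open
    -- cube.
    _ ≤ (volume.restrict (Set.pi univ fun i => Ioc (a i) (a i + 1))).map q :=
        Measure.map_mono (Measure.restrict_mono
          (Set.pi_mono fun i _ => Ioo_subset_Ioc_self) le_rfl) hq
    _ = volume := h1.map_eq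

end FlatTorus

end

section

/-! ### Metrics and coordinate fields on manifolds with translation charts -/

section TranslationMetric

variable {E : Type*} [NormedAddCommGroup E] [NormedSpace ℝ E]
  {H : Type*} [TopologicalSpace H] {I : ModelWithCorners ℝ E H}
  {M : Type*} [TopologicalSpace M] [ChartedSpace H M] [IsManifold I ∞ M]

/-- On a manifold whose transition maps are translations, a smooth family of bilinear forms on the
model space is a smooth tensor field. -/
theorem HasTranslationCharts.contMDiff_bilin (hM : HasTranslationCharts I M)
    {G : M → E →L[ℝ] E →L[ℝ] ℝ} (hG : ContMDiff I 𝓘(ℝ, E →L[ℝ] E →L[ℝ] ℝ) ∞ G) :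
    ContMDiff I (I.prod 𝓘(ℝ, E →L[ℝ] E →L[ℝ] ℝ)) ∞
      (fun z => TotalSpace.mk' (E →L[ℝ] E →L[ℝ] ℝ)
        (E := fun z : M => TangentSpace I z →L[ℝ] TangentSpace I z →L[ℝ] ℝ) z (G z)) := by
  intro x
  rw [contMDiffAt_hom_bundle]
  refine ⟨contMDiffAt_id, (hG x).congr_of_eventuallyEq ?_⟩
  filter_upwards [chart_source_mem_nhds H x] with z hz
  have hz' : z ∈ (trivializationAt E (TangentSpace I : M → Type _) x).baseSet := by
    simpa using hz
  -- The trivialization around `x` acts as the identity on fibres over the chart domain, so the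
  -- tensor field read in it is `G` itself.
  have key : ∀ v : E, (trivializationAt E (TangentSpace I : M → Type _) x).symm z v = v := by
    intro v
    have h := TangentBundle.symmL_trivializationAt_eq_core (I := I) hz
    rw [hM.coordChange_eq_id hz (mem_chart_source H z)] at h
    exact (Trivialization.symmL_apply (R := ℝ) _ hz' v).symm.trans
      (congrArg (fun L : E →L[ℝ] TangentSpace I z => L v) h)
  ext v w
  refine (inCoordinates_apply_eq₂ (E₁ := (TangentSpace I : M → Type _))
    (E₂ := (TangentSpace I : M → Type _)) (E₃ := Bundle.Trivial M ℝ) (F₁ := E) (F₂ := E) (F₃ := ℝ)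
    hz' hz' (Set.mem_univ _)).trans ?_
  rw [key, key]
  exact congrFun (Trivialization.coe_linearMapAt_of_mem (R := ℝ)
    (trivializationAt ℝ (Bundle.Trivial M ℝ) x) (Set.mem_univ z)) (G z v w)

/-- A smooth family of inner products on the model space is a Riemannian metric on a manifold whose
transition maps are translations. -/
def translationMetric (hM : HasTranslationCharts I M) (G : M → E →L[ℝ] E →L[ℝ] ℝ)
    (hG : ContMDiff I 𝓘(ℝ, E →L[ℝ] E →L[ℝ] ℝ) ∞ G) (hsymm : ∀ z v w, G z v w = G z w v)
    (hpos : ∀ z, ∃ c > 0, ∀ v, c * ‖v‖ ^ 2 ≤ G z v v) :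
    ContMDiffRiemannianMetric I ∞ E (fun z : M => TangentSpace I z) where
  inner z := G z
  symm := hsymm
  pos z v hv := by
    obtain ⟨c, hc, h⟩ := hpos z
    have : 0 < ‖(show E from v)‖ := norm_pos_iff.2 hv
    exact lt_of_lt_of_le (by positivity) (h v)
  -- Coercivity places the unit ball of the form inside a norm ball.
  isVonNBounded z := by
    obtain ⟨c, hc, h⟩ := hpos z
    change Bornology.IsVonNBounded ℝ {v : E | G z v v < 1}
    refine (NormedSpace.isVonNBounded_ball ℝ E (√(1 / c))).subset fun v hv => ?_
    rw [mem_ball_zero_iff]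
    refine Real.lt_sqrt_of_sq_lt ?_
    rw [lt_div_iff₀ hc, mul_comm]
    exact (h v).trans_lt hv
  contMDiff := hM.contMDiff_bilin hG

variable {ι : Type*}

omit [IsManifold I ∞ M] in
-- The manifold derivative is read in the preferred chart of the image point, which may differ from
-- the chart around `x`; the two differ by a translation.
theorem HasTranslationCharts.coordVec_eq (hM : HasTranslationCharts I M) (b : Module.Basis ι ℝ E)
    (x : M) {y : E} (hy : y ∈ (extChartAt I x).target) (i : ι) : coordVec I b x y i = b i := by
  have hz := (extChartAt I x).map_target hy
  have h := hM.hasFDerivAt hz (mem_extChartAt_source ((extChartAt I x).symm y))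
  rw [(extChartAt I x).right_inv hy] at h
  have hm : HasMFDerivAt 𝓘(ℝ, E) I (extChartAt I x).symm y
      (ContinuousLinearMap.id ℝ E :
        TangentSpace 𝓘(ℝ, E) y →L[ℝ] TangentSpace I ((extChartAt I x).symm y)) :=
    ⟨continuousAt_extChartAt_symm'' hy, h.hasFDerivWithinAt⟩
  rw [coordVec, hm.mfderiv]
  rfl

theorem gram_eq (g : ContMDiffRiemannianMetric I ∞ E (fun z : M => TangentSpace I z))
    (hM : HasTranslationCharts I M) (b : Module.Basis ι ℝ E)
    (x : M) {y : E} (hy : y ∈ (extChartAt I x).target) :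
    gram g b x y = Matrix.of fun i j => g.inner ((extChartAt I x).symm y) (b i) (b j) := by
  ext i j
  simp only [gram, Matrix.of_apply, hM.coordVec_eq b x hy]

end TranslationMetric

end

section

/-! ### Conformal products of the plane with a flat torus -/

/-- The flat metric on the torus. -/
def flatMetric (d : ℕ) : ContMDiffRiemannianMetric (𝓡 d) ∞ (Euc d)
    (fun y : FlatTorus d => TangentSpace (𝓡 d) y) :=
  translationMetric (FlatTorus.hasTranslationCharts d) (fun _ => innerSL ℝ) contMDiff_const
    (fun _ v w => real_inner_comm w v)
    (fun _ => ⟨1, one_pos, fun v => by rw [one_mul]; exact (real_inner_self_eq_norm_sq v).ge⟩)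

/-- The inner product of the plane, as a bilinear form on `ℝ² × ℝᵈ`. -/
def planeForm (d : ℕ) : (Euc 2 × Euc d) →L[ℝ] (Euc 2 × Euc d) →L[ℝ] ℝ :=
  (innerSL ℝ : Euc 2 →L[ℝ] Euc 2 →L[ℝ] ℝ).bilinearComp
    (ContinuousLinearMap.fst ℝ (Euc 2) (Euc d)) (ContinuousLinearMap.fst ℝ (Euc 2) (Euc d))

/-- The inner product of `ℝᵈ`, as a bilinear form on `ℝ² × ℝᵈ`. -/
def fiberForm (d : ℕ) : (Euc 2 × Euc d) →L[ℝ] (Euc 2 × Euc d) →L[ℝ] ℝ :=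
  (innerSL ℝ : Euc d →L[ℝ] Euc d →L[ℝ] ℝ).bilinearComp
    (ContinuousLinearMap.snd ℝ (Euc 2) (Euc d)) (ContinuousLinearMap.snd ℝ (Euc 2) (Euc d))

/-- The bilinear form `lam² dx² + h` on `ℝ² × ℝᵈ`. -/
def conformalForm (d : ℕ) (lam : Euc 2 → ℝ) (x : Euc 2) :
    (Euc 2 × Euc d) →L[ℝ] (Euc 2 × Euc d) →L[ℝ] ℝ :=
  lam x ^ 2 • planeForm d + fiberForm d

theorem conformalForm_apply {d : ℕ} (lam : Euc 2 → ℝ) (x : Euc 2) (v w : Euc 2 × Euc d) :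
    conformalForm d lam x v w = lam x ^ 2 * inner ℝ v.1 w.1 + inner ℝ v.2 w.2 := by
  rfl

theorem contDiff_sq_smul_add_const {X F : Type*} [NormedAddCommGroup X] [NormedSpace ℝ X]
    [NormedAddCommGroup F] [NormedSpace ℝ F] {lam : X → ℝ} (hlam : ContDiff ℝ ∞ lam)
    (A B : F) : ContDiff ℝ ∞ (fun x => lam x ^ 2 • A + B) :=
  ((hlam.pow 2).smul contDiff_const).add contDiff_const

theorem contDiff_conformalForm (d : ℕ) {lam : Euc 2 → ℝ} (hlam : ContDiff ℝ ∞ lam) :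
    ContDiff ℝ ∞ (conformalForm d lam) :=
  contDiff_sq_smul_add_const hlam (planeForm d) (fiberForm d)

theorem hasTranslationCharts_plane_prod_torus (d : ℕ) :
    HasTranslationCharts ((𝓡 2).prod (𝓡 d)) (Euc 2 × FlatTorus d) :=
  (hasTranslationCharts_modelSpace (Euc 2)).prod (FlatTorus.hasTranslationCharts d)

variable {d : ℕ} {lam : Euc 2 → ℝ}

/-- The metric `lam² dx² + h` on the product of the plane with the flat torus. -/
def conformalMetric (d : ℕ) (hlam : ContDiff ℝ ∞ lam) (hpos : ∀ x, 0 < lam x) :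
    ContMDiffRiemannianMetric ((𝓡 2).prod (𝓡 d)) ∞ (Euc 2 × Euc d)
      (fun z : Euc 2 × FlatTorus d => TangentSpace ((𝓡 2).prod (𝓡 d)) z) :=
  translationMetric (hasTranslationCharts_plane_prod_torus d)
    (fun z => conformalForm d lam z.1)
    ((contDiff_conformalForm d hlam).contMDiff.comp contMDiff_fst)
    (fun z v w => by
      rw [conformalForm_apply, conformalForm_apply, real_inner_comm, real_inner_comm w.2])
    (fun z => by
      refine ⟨min (lam z.1 ^ 2) 1, lt_min (pow_pos (hpos _) 2) one_pos, fun v => ?_⟩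
      rw [conformalForm_apply, real_inner_self_eq_norm_sq, real_inner_self_eq_norm_sq, Prod.norm_def]
      have h0 : 0 < min (lam z.1 ^ 2) 1 := lt_min (pow_pos (hpos _) 2) one_pos
      have h1 := mul_le_mul_of_nonneg_right (min_le_left (lam z.1 ^ 2) 1) (sq_nonneg ‖v.1‖)
      have h2 := mul_le_mul_of_nonneg_right (min_le_right (lam z.1 ^ 2) 1) (sq_nonneg ‖v.2‖)
      have h3 := mul_nonneg h0.le (sq_nonneg ‖v.1‖)
      have h4 := mul_nonneg h0.le (sq_nonneg ‖v.2‖)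
      -- The product carries the sup norm, so only the larger of the two components has to be
      -- dominated.
      rcases max_cases ‖v.1‖ ‖v.2‖ with h | h <;> rw [h.1] <;> linarith)

variable (hlam : ContDiff ℝ ∞ lam) (hpos : ∀ x, 0 < lam x)

theorem conformalMetric_inner (z : Euc 2 × FlatTorus d) (v w : Euc 2 × Euc d) :
    (conformalMetric d hlam hpos).inner z v w =
      lam z.1 ^ 2 * inner ℝ v.1 w.1 + inner ℝ v.2 w.2 :=
  conformalForm_apply lam z.1 v w

theorem isConformalProduct_conformalMetric :
    IsConformalProduct lam (flatMetric d) (conformalMetric d hlam hpos) :=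
  fun x y v₁ w₁ v₂ w₂ => conformalForm_apply lam x (v₁, v₂) (w₁, w₂)

theorem extChartAt_target_plane_prod_torus (x : Euc 2 × FlatTorus d) :
    (extChartAt ((𝓡 2).prod (𝓡 d)) x).target =
      univ ×ˢ (FlatTorus.chart (FlatTorus.corner x.2)).target := by
  rw [extChartAt_prod, PartialEquiv.prod_target]
  have h : (extChartAt (𝓡 d) x.2).target = (FlatTorus.chart (FlatTorus.corner x.2)).target := by
    simp only [extChartAt, OpenPartialHomeomorph.extend, PartialEquiv.trans_target]
    simp
    rfl
  have h' : (extChartAt (𝓡 2) x.1).target = univ := by simp [chartAt_self_eq]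
  rw [h, h']

theorem extChartAt_symm_plane_prod_torus (x : Euc 2 × FlatTorus d) (y : Euc 2 × Euc d) :
    (extChartAt ((𝓡 2).prod (𝓡 d)) x).symm y = (y.1, FlatTorus.mk y.2) :=
  rfl

theorem extChartAt_plane_prod_torus_fst (x z : Euc 2 × FlatTorus d) :
    (extChartAt ((𝓡 2).prod (𝓡 d)) x z).1 = z.1 :=
  rfl

theorem stdBasis_inl (i : Fin 2) : stdBasis d (Sum.inl i) = (EuclideanSpace.single i 1, 0) := by
  simp [stdBasis]

theorem stdBasis_inr (i : Fin d) : stdBasis d (Sum.inr i) = (0, EuclideanSpace.single i 1) := by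
  simp [stdBasis]

theorem gram_conformalMetric (x : Euc 2 × FlatTorus d) {y : Euc 2 × Euc d}
    (hy : y ∈ (extChartAt ((𝓡 2).prod (𝓡 d)) x).target) :
    gram (conformalMetric d hlam hpos) (stdBasis d) x y =
      Matrix.diagonal (Sum.elim (fun _ => lam y.1 ^ 2) (fun _ => 1)) := by
  rw [gram_eq _ (hasTranslationCharts_plane_prod_torus d) _ _ hy]
  ext i j
  rw [Matrix.of_apply]
  refine (conformalMetric_inner hlam hpos _ _ _).trans ?_
  rw [extChartAt_symm_plane_prod_torus]
  rcases i with i | i <;> rcases j with j | j <;>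
    simp [stdBasis_inl, stdBasis_inr, Matrix.diagonal_apply, EuclideanSpace.inner_single_left,
      eq_comm]

theorem volDensity_conformalMetric (x : Euc 2 × FlatTorus d) {y : Euc 2 × Euc d}
    (hy : y ∈ (extChartAt ((𝓡 2).prod (𝓡 d)) x).target) :
    volDensity (conformalMetric d hlam hpos) (stdBasis d) x y = lam y.1 ^ 2 := by
  rw [volDensity, gram_conformalMetric hlam hpos x hy, Matrix.det_diagonal]
  simp only [Fintype.prod_sum_type, Sum.elim_inl, Sum.elim_inr, Finset.prod_const_one, mul_one,
    Finset.prod_const, Finset.card_univ, Fintype.card_fin]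
  exact Real.sqrt_sq (sq_nonneg _)

theorem coordGrad_conformalMetric {u : Euc 2 → ℝ} (hu : Differentiable ℝ u)
    (x : Euc 2 × FlatTorus d) {y : Euc 2 × Euc d}
    (hy : y ∈ (extChartAt ((𝓡 2).prod (𝓡 d)) x).target) :
    coordGrad (conformalMetric d hlam hpos) (stdBasis d) (fun z => u z.1) x y =
      Sum.elim (fun i => (lam y.1 ^ 2)⁻¹ * fderiv ℝ u y.1 (EuclideanSpace.single i 1))
        (fun _ => 0) := by
  have hinv : (gram (conformalMetric d hlam hpos) (stdBasis d) x y)⁻¹ =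
      Matrix.diagonal (Sum.elim (fun _ => (lam y.1 ^ 2)⁻¹) (fun _ => 1)) := by
    rw [gram_conformalMetric hlam hpos x hy]
    refine Matrix.inv_eq_right_inv ?_
    rw [Matrix.diagonal_mul_diagonal, ← Matrix.diagonal_one]
    congr 1
    ext i
    rcases i with i | i
    · simp [(hpos y.1).ne']
    · simp
  have hd : fderiv ℝ ((fun z : Euc 2 × FlatTorus d => u z.1) ∘
      (extChartAt ((𝓡 2).prod (𝓡 d)) x).symm) y =
        (fderiv ℝ u y.1).comp (ContinuousLinearMap.fst ℝ (Euc 2) (Euc d)) :=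
    ((hu y.1).hasFDerivAt.comp y hasFDerivAt_fst).fderiv
  rw [coordGrad, hinv, hd]
  ext i
  rw [Matrix.mulVec_diagonal]
  rcases i with i | i
  · simp [stdBasis_inl]
  · simp [stdBasis_inr]

theorem gradNorm_conformalMetric {u : Euc 2 → ℝ} (hu : Differentiable ℝ u)
    (z : Euc 2 × FlatTorus d) :
    gradNorm (conformalMetric d hlam hpos) (stdBasis d) (fun z => u z.1) z =
      √(∑ i, ((lam z.1)⁻¹ * fderiv ℝ u z.1 (EuclideanSpace.single i 1)) ^ 2) := by
  have hy := mem_extChartAt_target (I := (𝓡 2).prod (𝓡 d)) z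
  rw [gradNorm, coordGrad_conformalMetric hlam hpos hu z hy, gram_conformalMetric hlam hpos z hy,
    extChartAt_plane_prod_torus_fst]
  congr 1
  simp only [dotProduct, Matrix.mulVec_diagonal, Fintype.sum_sum_type, Sum.elim_inl, Sum.elim_inr,
    mul_zero, Finset.sum_const_zero, add_zero]
  refine Finset.sum_congr rfl fun i _ => ?_
  have := (hpos z.1).ne'
  field_simp

/-- The Laplacian of the Euclidean plane. -/
def planeLaplacian (u : Euc 2 → ℝ) (x : Euc 2) : ℝ :=
  ∑ i, fderiv ℝ (fun x => fderiv ℝ u x (EuclideanSpace.single i 1)) x (EuclideanSpace.single i 1)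

/-- Conformal covariance in dimension two: the density `lam²` cancels the factor `lam⁻²` of the
gradient components, leaving the Euclidean divergence divided by the density. -/
theorem laplacian_conformalMetric {u : Euc 2 → ℝ} (hu : ContDiff ℝ 2 u)
    (z : Euc 2 × FlatTorus d) :
    laplacian (conformalMetric d hlam hpos) (stdBasis d) (fun z => u z.1) z =
      (lam z.1 ^ 2)⁻¹ * planeLaplacian u z.1 := by
  have hy := mem_extChartAt_target (I := (𝓡 2).prod (𝓡 d)) z
  have ht := extChartAt_target_mem_nhds (I := (𝓡 2).prod (𝓡 d)) z
  have hu1 : Differentiable ℝ u := hu.differentiable (by norm_num)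
  have hu2 : ∀ v : Euc 2, Differentiable ℝ (fun x => fderiv ℝ u x v) := fun v =>
    ((hu.fderiv_right (m := 1) (by norm_num)).clm_apply contDiff_const).differentiable (by norm_num)
  rw [laplacian, volDensity_conformalMetric hlam hpos z hy, extChartAt_plane_prod_torus_fst,
    Fintype.sum_sum_type, planeLaplacian]
  have hr : ∀ i : Fin d, fderiv ℝ (fun y => volDensity (conformalMetric d hlam hpos) (stdBasis d) z y *
      coordGrad (conformalMetric d hlam hpos) (stdBasis d) (fun z => u z.1) z y (Sum.inr i))
      (extChartAt ((𝓡 2).prod (𝓡 d)) z z) = 0 := by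
    intro i
    refine HasFDerivAt.fderiv ((hasFDerivAt_const (0 : ℝ) _).congr_of_eventuallyEq ?_)
    filter_upwards [ht] with y hy
    rw [coordGrad_conformalMetric hlam hpos hu1 z hy]
    simp
  have hl : ∀ i : Fin 2, fderiv ℝ (fun y => volDensity (conformalMetric d hlam hpos) (stdBasis d) z y *
      coordGrad (conformalMetric d hlam hpos) (stdBasis d) (fun z => u z.1) z y (Sum.inl i))
      (extChartAt ((𝓡 2).prod (𝓡 d)) z z) =
      (fderiv ℝ (fun x => fderiv ℝ u x (EuclideanSpace.single i 1)) z.1).comp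
        (ContinuousLinearMap.fst ℝ (Euc 2) (Euc d)) := by
    intro i
    refine HasFDerivAt.fderiv (HasFDerivAt.congr_of_eventuallyEq
      (((hu2 (EuclideanSpace.single i 1)) z.1).hasFDerivAt.comp
        (extChartAt ((𝓡 2).prod (𝓡 d)) z z) hasFDerivAt_fst) ?_)
    filter_upwards [ht] with y hy
    rw [coordGrad_conformalMetric hlam hpos hu1 z hy, volDensity_conformalMetric hlam hpos z hy]
    have := (hpos y.1).ne'
    simp only [Sum.elim_inl, Function.comp_apply]
    field_simp
  simp only [hr, hl]
  simp [stdBasis_inl]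

end

section

/-! ### The volume of a conformal product, and `Lᵖ` norms on it -/

variable {d : ℕ} {lam : Euc 2 → ℝ} (hlam : ContDiff ℝ ∞ lam) (hpos : ∀ x, 0 < lam x)

theorem addHaar_stdBasis (d : ℕ) :
    (stdBasis d).addHaar = (volume : Measure (Euc 2)).prod (volume : Measure (Euc d)) := by
  rw [stdBasis, Module.Basis.prod_addHaar, OrthonormalBasis.addHaar_eq_volume,
    OrthonormalBasis.addHaar_eq_volume]

theorem measurable_prodMap_mk : Measurable (Prod.map id FlatTorus.mk : Euc 2 × Euc d → _) :=
  measurable_id.prodMap FlatTorus.continuous_mk.measurable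

theorem chartVolume_conformalMetric (x : Euc 2 × FlatTorus d) :
    chartVolume (conformalMetric d hlam hpos) (stdBasis d) x =
      (((volume : Measure (Euc 2)).prod
        ((volume : Measure (Euc d)).restrict (FlatTorus.chart (FlatTorus.corner x.2)).target)).withDensity
          fun y => ENNReal.ofReal (lam y.1 ^ 2)).map (Prod.map id FlatTorus.mk) := by
  rw [chartVolume]
  change Measure.map (Prod.map id FlatTorus.mk) _ = _
  congr 1
  have hm : MeasurableSet (extChartAt ((𝓡 2).prod (𝓡 d)) x).target :=
    (isOpen_extChartAt_target x).measurableSet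
  have h : (volume : Measure (Euc 2)).prod
      ((volume : Measure (Euc d)).restrict (FlatTorus.chart (FlatTorus.corner x.2)).target) =
      (stdBasis d).addHaar.restrict (extChartAt ((𝓡 2).prod (𝓡 d)) x).target := by
    rw [extChartAt_target_plane_prod_torus, addHaar_stdBasis, ← Measure.prod_restrict,
      Measure.restrict_univ]
  rw [h]
  refine withDensity_congr_ae ?_
  filter_upwards [ae_restrict_mem hm] with y hy
  rw [volDensity_conformalMetric hlam hpos x hy]

/-- A supremum of measures is bounded by testing each chart separately: the density is at most one,
and the covering map does not increase measure on a cube. -/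
theorem volumeMeasure_conformalMetric_le (hle : ∀ x, lam x ≤ 1) :
    volumeMeasure (conformalMetric d hlam hpos) (stdBasis d) ≤
      (volume : Measure (Euc 2)).prod (volume : Measure (FlatTorus d)) := by
  refine iSup_le fun x => ?_
  rw [chartVolume_conformalMetric]
  refine (Measure.map_mono (ν := (volume : Measure (Euc 2)).prod ((volume : Measure (Euc d)).restrict
    (FlatTorus.chart (FlatTorus.corner x.2)).target)) ?_ measurable_prodMap_mk).trans ?_
  · conv_rhs => rw [← withDensity_one (μ := (volume : Measure (Euc 2)).prod _)]
    refine withDensity_mono (Eventually.of_forall fun y => ?_)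
    refine ENNReal.ofReal_le_one.2 ?_
    exact pow_le_one₀ (hpos _).le (hle _)
  · have := FlatTorus.map_mk_restrict_chart_target_le (FlatTorus.corner x.2)
    have hf : IsFiniteMeasure (((volume : Measure (Euc d)).restrict
        (FlatTorus.chart (FlatTorus.corner x.2)).target).map FlatTorus.mk) :=
      isFiniteMeasure_of_le _ this
    rw [← Measure.map_prod_map _ _ measurable_id FlatTorus.continuous_mk.measurable, Measure.map_id]
    exact Measure.prod_mono le_rfl this

/-- A single chart is enough, since its volume lies below the supremum and it misses no direction of
the plane. -/
theorem le_volumeMeasure_conformalMetric (x : FlatTorus d) {s : Set (Euc 2)} (hs : MeasurableSet s)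
    {ε : ℝ} (hε : 0 ≤ ε) (h : ∀ x ∈ s, ε ≤ lam x) :
    ENNReal.ofReal (ε ^ 2) *
        (volume s * volume (FlatTorus.chart (FlatTorus.corner x)).target) ≤
      volumeMeasure (conformalMetric d hlam hpos) (stdBasis d) (s ×ˢ univ) := by
  have h1 : chartVolume (conformalMetric d hlam hpos) (stdBasis d) (0, x) ≤
    volumeMeasure (conformalMetric d hlam hpos) (stdBasis d) := le_iSup _ _
  refine le_trans ?_ (h1 _)
  rw [chartVolume_conformalMetric, Measure.map_apply measurable_prodMap_mk (hs.prod .univ)]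
  have h2 : Prod.map id FlatTorus.mk ⁻¹' (s ×ˢ (univ : Set (FlatTorus d))) = s ×ˢ univ := by
    ext; simp
  rw [h2, withDensity_apply _ (hs.prod .univ)]
  calc _ = ∫⁻ _ in s ×ˢ univ, ENNReal.ofReal (ε ^ 2) ∂((volume : Measure (Euc 2)).prod
        ((volume : Measure (Euc d)).restrict (FlatTorus.chart (FlatTorus.corner x)).target)) := by
        rw [setLIntegral_const, Measure.prod_prod, Measure.restrict_apply_univ]
    _ ≤ _ := by
        refine setLIntegral_mono' (hs.prod .univ) fun y hy => ENNReal.ofReal_le_ofReal ?_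
        exact pow_le_pow_left₀ hε (h _ hy.1) 2

variable {p : ℝ} {f : Euc 2 × FlatTorus d → ℝ}

/-- The bound does not depend on the centre `c`, because Lebesgue measure is translation invariant
and the torus has mass one. This gives uniformity in `k` later. -/
theorem lpNorm_conformalMetric_le (hle : ∀ x, lam x ≤ 1) (hp : 0 < p) {C r : ℝ} (c : Euc 2)
    (hC : ∀ z, |f z| ≤ C) (hf : ∀ z, z.1 ∉ Metric.closedBall c r → f z = 0) :
    lpNorm (conformalMetric d hlam hpos) (stdBasis d) p f ≤
      ENNReal.ofReal C * volume (Metric.closedBall (0 : Euc 2) r) ^ (1 / p) := by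
  have hC0 : 0 ≤ C := (abs_nonneg _).trans (hC (0, fun _ => 0))
  calc lpNorm (conformalMetric d hlam hpos) (stdBasis d) p f
      ≤ eLpNorm f (ENNReal.ofReal p)
          ((volume : Measure (Euc 2)).prod (volume : Measure (FlatTorus d))) :=
        eLpNorm_mono_measure _ (volumeMeasure_conformalMetric_le hlam hpos hle)
    _ ≤ eLpNorm ((Metric.closedBall c r ×ˢ univ).indicator fun _ => C) (ENNReal.ofReal p)
          ((volume : Measure (Euc 2)).prod (volume : Measure (FlatTorus d))) := by
        refine eLpNorm_mono_real fun z => ?_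
        by_cases hz : z.1 ∈ Metric.closedBall c r
        · rw [indicator_of_mem (by exact ⟨hz, mem_univ _⟩)]
          exact hC z
        · rw [hf z hz, norm_zero]
          exact indicator_nonneg (fun _ _ => hC0) _
    _ ≤ _ := eLpNorm_indicator_const_le _ _
    _ = _ := by
        rw [Measure.prod_prod, measure_univ, mul_one, Measure.addHaar_closedBall_center,
          ENNReal.toReal_ofReal hp.le, Real.enorm_eq_ofReal hC0]

theorem le_lpNorm_conformalMetric (hp : 0 < p) {s : Set (Euc 2)} (hs : MeasurableSet s) {C : ℝ}
    (hC : 0 ≤ C) (hf : ∀ z, z.1 ∈ s → C ≤ f z) :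
    ENNReal.ofReal C *
        volumeMeasure (conformalMetric d hlam hpos) (stdBasis d) (s ×ˢ univ) ^ (1 / p) ≤
      lpNorm (conformalMetric d hlam hpos) (stdBasis d) p f := by
  calc _ = eLpNorm ((s ×ˢ univ).indicator fun _ => C) (ENNReal.ofReal p)
          (volumeMeasure (conformalMetric d hlam hpos) (stdBasis d)) := by
        rw [eLpNorm_indicator_const (hs.prod .univ) (by simpa using hp) ENNReal.ofReal_ne_top,
          ENNReal.toReal_ofReal hp.le, Real.enorm_eq_ofReal hC]
    _ ≤ _ := by
        refine eLpNorm_mono fun z => ?_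
        by_cases hz : z.1 ∈ s
        · rw [indicator_of_mem (by exact ⟨hz, mem_univ _⟩), Real.norm_of_nonneg hC]
          exact (hf z hz).trans (le_abs_self _)
        · rw [indicator_of_notMem (by simpa using hz), norm_zero]
          exact norm_nonneg _

theorem volume_chart_target_pos (x : FlatTorus d) :
    0 < volume (FlatTorus.chart (FlatTorus.corner x)).target :=
  (FlatTorus.chart _).open_target.measure_pos _
    ⟨_, (FlatTorus.chart _).map_source (FlatTorus.mem_chart_corner_source x)⟩

end

section

/-! ### Completeness -/

section Complete

variable {E : Type*} [NormedAddCommGroup E] [NormedSpace ℝ E]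
  {H : Type*} [TopologicalSpace H] {I : ModelWithCorners ℝ E H}
  {M : Type*} [TopologicalSpace M] [ChartedSpace H M] [IsManifold I ∞ M]
  (g : ContMDiffRiemannianMetric I ∞ E (fun z : M => TangentSpace I z))

/-- A function whose differential has norm at most one is `1`-Lipschitz for the Riemannian
distance. -/
theorem edist_le_rdist {f : M → ℝ} (f' : ∀ z : M, TangentSpace I z →L[ℝ] ℝ)
    (hf : ContMDiff I 𝓘(ℝ, ℝ) 1 f)
    (hf' : ∀ z, HasMFDerivAt I 𝓘(ℝ, ℝ) f z (f' z))
    (hle : ∀ (z : M) (v : TangentSpace I z), f' z v ^ 2 ≤ g.inner z v v) (x y : M) :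
    edist (f x) (f y) ≤ rdist g x y := by
  let _ : RiemannianBundle (fun z : M => TangentSpace I z) := ⟨g.toRiemannianMetric⟩
  refine le_of_forall_gt fun r hr => ?_
  obtain ⟨γ, h0, h1, hγ, hlt⟩ := exists_lt_of_riemannianEDist_lt hr
  refine lt_of_le_of_lt ?_ hlt
  -- Along a path, `|(f ∘ γ)'|` is at most the speed of `γ`; integrating bounds the increment of `f`
  -- by the length.
  have hD : ContDiffOn ℝ 1 (f ∘ γ) (Icc 0 1) :=
    contMDiffOn_iff_contDiffOn.mp (hf.comp_contMDiffOn hγ)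
  have h2 := enorm_sub_le_lintegral_derivWithin_Icc_of_contDiffOn_Icc hD zero_le_one
  rw [Function.comp_apply, Function.comp_apply, h0, h1, ← edist_eq_enorm_sub, edist_comm] at h2
  refine h2.trans ?_
  rw [pathELength_eq_lintegral_mfderivWithin_Icc]
  refine setLIntegral_mono' measurableSet_Icc fun t ht => ?_
  have hu : UniqueMDiffWithinAt 𝓘(ℝ, ℝ) (Icc (0 : ℝ) 1) t :=
    (uniqueDiffOn_Icc one_pos t ht).uniqueMDiffWithinAt
  have hγt : MDifferentiableWithinAt 𝓘(ℝ, ℝ) I γ (Icc 0 1) t :=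
    (hγ t ht).mdifferentiableWithinAt one_ne_zero
  have hc := ((hf' (γ t)).comp_hasMFDerivWithinAt t hγt.hasMFDerivWithinAt).mfderivWithin hu
  have hd : derivWithin (f ∘ γ) (Icc 0 1) t =
      f' (γ t) (mfderivWithin 𝓘(ℝ, ℝ) I γ (Icc 0 1) t (1 : ℝ)) := by
    rw [← fderivWithin_derivWithin, ← mfderivWithin_eq_fderivWithin, hc]
    rfl
  rw [hd, enorm_le_iff_norm_le]
  set v : TangentSpace I (γ t) := mfderivWithin 𝓘(ℝ, ℝ) I γ (Icc 0 1) t (1 : ℝ)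
  have hn : g.inner (γ t) v v = ‖v‖ ^ 2 := real_inner_self_eq_norm_sq v
  exact abs_le_of_sq_le_sq ((hle _ v).trans_eq hn) (norm_nonneg _)

/-- If Cauchy sequences for the Riemannian distance are eventually contained in compact sets, then
the Riemannian manifold is complete. -/
theorem isComplete_of_eventually_mem_isCompact [RegularSpace M]
    (h : ∀ s : ℕ → M,
      (∀ ε : ℝ≥0∞, 0 < ε → ∃ K, ∀ j ≥ K, ∀ k ≥ K, rdist g (s j) (s k) < ε) →
        ∃ K : Set M, IsCompact K ∧ ∀ᶠ k in atTop, s k ∈ K) : IsComplete g := by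
  let _ : RiemannianBundle (fun z : M => TangentSpace I z) := ⟨g.toRiemannianMetric⟩
  have _ : IsContinuousRiemannianBundle E (fun z : M => TangentSpace I z) :=
    ⟨g.inner, g.contMDiff.continuous, fun _ _ _ => rfl⟩
  intro s hs
  obtain ⟨K, hK, hsK⟩ := h s hs
  obtain ⟨x, -, hx⟩ := hK.exists_mapClusterPt (tendsto_principal.2 hsK)
  refine ⟨x, fun U hU => ?_⟩
  -- Small Riemannian balls fit into any neighbourhood of the cluster point, so a Cauchy sequence
  -- converges to it.
  obtain ⟨c, hc, hcU⟩ := setOfPred_riemannianEDist_lt_subset_nhds' I hU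
  obtain ⟨K₁, hK₁⟩ := hs (c / 2) (ENNReal.half_pos hc.ne')
  have hfr := hx.frequently (eventually_riemannianEDist_lt I x (ENNReal.half_pos hc.ne'))
  obtain ⟨k, hk, hkx⟩ := (hfr.and_eventually (eventually_ge_atTop K₁)).exists.imp fun k hk => hk.symm
  change ∀ᶠ j in atTop, s j ∈ U
  filter_upwards [eventually_ge_atTop K₁] with j hj
  refine hcU ?_
  calc riemannianEDist I x (s j) ≤ riemannianEDist I x (s k) + riemannianEDist I (s k) (s j) :=
        riemannianEDist_triangle
    _ < c / 2 + c / 2 := ENNReal.add_lt_add hkx (hK₁ k hk j hj)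
    _ = c := ENNReal.add_halves c

end Complete

/-! ### Proper functions that ignore the spikes -/

/-- The derivative of `staircase`: it vanishes at distance at most `1 / 4` from the integers. -/
def staircaseDeriv (t : ℝ) : ℝ := max 0 (-Real.cos (2 * Real.pi * t))

/-- A proper nondecreasing function on the line, which is constant near every integer. -/
def staircase (t : ℝ) : ℝ := ∫ s in (0 : ℝ)..t, staircaseDeriv s

theorem continuous_staircaseDeriv : Continuous staircaseDeriv := by
  unfold staircaseDeriv
  fun_prop

theorem hasDerivAt_staircase (t : ℝ) : HasDerivAt staircase (staircaseDeriv t) t :=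
  continuous_staircaseDeriv.integral_hasStrictDerivAt 0 t |>.hasDerivAt

theorem contDiff_staircase : ContDiff ℝ 1 staircase := by
  rw [contDiff_one_iff_deriv]
  refine ⟨fun t => (hasDerivAt_staircase t).differentiableAt, ?_⟩
  rw [show deriv staircase = staircaseDeriv from funext fun t => (hasDerivAt_staircase t).deriv]
  exact continuous_staircaseDeriv

theorem staircaseDeriv_nonneg (t : ℝ) : 0 ≤ staircaseDeriv t := le_max_left _ _

theorem staircaseDeriv_le_one (t : ℝ) : staircaseDeriv t ≤ 1 :=
  max_le zero_le_one (by linarith [Real.neg_one_le_cos (2 * Real.pi * t)])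

theorem staircaseDeriv_eq_zero {t : ℝ} (m : ℕ) (h : |t - m| < 1 / 8) : staircaseDeriv t = 0 := by
  refine max_eq_left ?_
  have h1 : Real.cos (2 * Real.pi * t) = Real.cos (2 * Real.pi * (t - m)) := by
    rw [mul_sub, mul_comm _ (m : ℝ), Real.cos_sub_nat_mul_two_pi]
  rw [h1, neg_nonpos]
  rw [abs_lt] at h
  have := Real.pi_pos
  apply Real.cos_nonneg_of_neg_pi_div_two_le_of_le <;> nlinarith

theorem abs_le_staircase (t : ℝ) : |t| ≤ 4 * |staircase t| + 4 := by
  have hpi := Real.pi_gt_three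
  -- With `c = cos (2πt)`, the elementary bound `max 0 (-c) ≥ (c² - c) / 2` on `[-1, 1]` replaces
  -- the integrand by one with an explicit primitive `b`, which is `t / 4` plus a bounded periodic
  -- term.
  let b : ℝ → ℝ := fun t => t / 4 + Real.sin (2 * (2 * Real.pi * t)) / (16 * Real.pi) -
    Real.sin (2 * Real.pi * t) / (4 * Real.pi)
  have hb : ∀ t, HasDerivAt b
      ((Real.cos (2 * Real.pi * t) ^ 2 - Real.cos (2 * Real.pi * t)) / 2) t := by
    intro t
    have h1 : HasDerivAt (fun t : ℝ => 2 * Real.pi * t) (2 * Real.pi) t := by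
      simpa using (hasDerivAt_id t).const_mul (2 * Real.pi)
    have h2 := ((((hasDerivAt_id t).div_const 4).add
      ((h1.const_mul 2).sin.div_const (16 * Real.pi))).sub (h1.sin.div_const (4 * Real.pi)))
    refine h2.congr_deriv ?_
    rw [Real.cos_two_mul]
    field_simp
    ring
  have hbb : ∀ t, |b t - t / 4| ≤ 1 := by
    intro t
    have h1 := Real.abs_sin_le_one (2 * (2 * Real.pi * t))
    have h2 := Real.abs_sin_le_one (2 * Real.pi * t)
    have h3 : |Real.sin (2 * (2 * Real.pi * t)) / (16 * Real.pi)| ≤ 1 / 2 := by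
      rw [abs_div, abs_of_pos (by positivity : 0 < 16 * Real.pi), div_le_iff₀ (by positivity)]
      linarith
    have h4 : |Real.sin (2 * Real.pi * t) / (4 * Real.pi)| ≤ 1 / 2 := by
      rw [abs_div, abs_of_pos (by positivity : 0 < 4 * Real.pi), div_le_iff₀ (by positivity)]
      linarith
    rw [abs_le] at h3 h4 ⊢
    constructor <;> simp only [b] <;> linarith
  have hmono : Monotone (fun t => staircase t - b t) := by
    refine monotone_of_hasDerivAt_nonneg (fun t => (hasDerivAt_staircase t).sub (hb t)) fun t => ?_
    simp only [Pi.zero_apply, sub_nonneg, staircaseDeriv]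
    have h1 := Real.neg_one_le_cos (2 * Real.pi * t)
    have h2 := Real.cos_le_one (2 * Real.pi * t)
    rcases le_total 0 (Real.cos (2 * Real.pi * t)) with h | h
    · exact le_max_of_le_left (by nlinarith)
    · exact le_max_of_le_right (by nlinarith)
  have h0 : staircase 0 - b 0 = 0 := by simp [staircase, b]
  have hbt := abs_le.1 (hbb t)
  rcases le_total 0 t with ht | ht
  · have := hmono ht
    simp only [h0] at this
    rw [abs_of_nonneg ht]
    linarith [le_abs_self (staircase t)]
  · have := hmono ht
    simp only [h0] at this
    rw [abs_of_nonpos ht]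
    linarith [neg_le_abs (staircase t)]

variable {d : ℕ} {lam : Euc 2 → ℝ} (hlam : ContDiff ℝ ∞ lam) (hpos : ∀ x, 0 < lam x)

/-- Where the derivative of the staircase is nonzero the point lies outside every spike ball, so
`lam = 1` and the metric dominates the Euclidean one; elsewhere the differential vanishes. -/
theorem edist_staircase_le_rdist
    (hone : ∀ x : Euc 2, (∀ m : ℕ, x ∉ Metric.ball (!₂[(m : ℝ), 0] : Euc 2) (1 / 8)) → lam x = 1)
    (i : Fin 2) (x y : Euc 2 × FlatTorus d) :
    edist (staircase (x.1 i)) (staircase (y.1 i)) ≤ rdist (conformalMetric d hlam hpos) x y := by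
  have hF : ContDiff ℝ 1 (fun x : Euc 2 => staircase (x i)) :=
    contDiff_staircase.comp (EuclideanSpace.proj i : Euc 2 →L[ℝ] ℝ).contDiff
  have hF' : ∀ x : Euc 2, HasFDerivAt (fun x : Euc 2 => staircase (x i))
      (staircaseDeriv (x i) • (EuclideanSpace.proj i : Euc 2 →L[ℝ] ℝ)) x := fun x =>
    HasDerivAt.comp_hasFDerivAt (f := fun x : Euc 2 => x i) x (hasDerivAt_staircase (x i))
      (EuclideanSpace.proj i : Euc 2 →L[ℝ] ℝ).hasFDerivAt
  refine edist_le_rdist (conformalMetric d hlam hpos) (f := fun z => staircase (z.1 i))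
    (fun z => ((staircaseDeriv (z.1 i) • (EuclideanSpace.proj i : Euc 2 →L[ℝ] ℝ)).comp
      (ContinuousLinearMap.fst ℝ (Euc 2) (Euc d)) : (Euc 2 × Euc d) →L[ℝ] ℝ))
    (hF.contMDiff.comp contMDiff_fst) (fun z => ?_) (fun z v => ?_) x y
  · exact (hF' z.1).hasMFDerivAt.comp z (hasMFDerivAt_fst z)
  · have h1 : (staircaseDeriv (z.1 i) * v.1 i) ^ 2 ≤ lam z.1 ^ 2 * ‖v.1‖ ^ 2 := by
      rcases eq_or_ne (staircaseDeriv (z.1 i)) 0 with h | h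
      · rw [h, zero_mul, zero_pow two_ne_zero]
        exact mul_nonneg (sq_nonneg _) (sq_nonneg _)
      · have hl : lam z.1 = 1 := by
          refine hone _ fun m hm => h ?_
          rw [Metric.mem_ball, EuclideanSpace.dist_eq, Fin.sum_univ_two] at hm
          have hm2 := (Real.sqrt_lt' (by norm_num)).1 hm
          simp only [Real.dist_eq, sq_abs] at hm2
          fin_cases i
          · refine staircaseDeriv_eq_zero m (abs_lt_of_sq_lt_sq ?_ (by norm_num))
            refine lt_of_le_of_lt ?_ hm2
            simpa using sq_nonneg _
          -- All spikes lie on the first axis, so here the nearby integer is `0`, whatever `m` is.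
          · refine staircaseDeriv_eq_zero 0 (abs_lt_of_sq_lt_sq ?_ (by norm_num))
            refine lt_of_le_of_lt ?_ hm2
            simpa using sq_nonneg _
        rw [hl, mul_pow, one_pow, one_mul]
        have h2 : staircaseDeriv (z.1 i) ^ 2 ≤ 1 :=
          pow_le_one₀ (staircaseDeriv_nonneg _) (staircaseDeriv_le_one _)
        have h3 : v.1 i ^ 2 ≤ ‖v.1‖ ^ 2 :=
          sq_le_sq' (abs_le.1 (PiLp.norm_apply_le v.1 i)).1 (abs_le.1 (PiLp.norm_apply_le v.1 i)).2
        nlinarith [sq_nonneg (v.1 i)]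
    refine h1.trans ?_
    refine le_of_le_of_eq ?_ (conformalMetric_inner hlam hpos z v v).symm
    rw [real_inner_self_eq_norm_sq, real_inner_self_eq_norm_sq]
    exact le_add_of_nonneg_right (sq_nonneg _)

theorem isComplete_conformalMetric
    (hone : ∀ x : Euc 2, (∀ m : ℕ, x ∉ Metric.ball (!₂[(m : ℝ), 0] : Euc 2) (1 / 8)) → lam x = 1) :
    IsComplete (conformalMetric d hlam hpos) := by
  refine isComplete_of_eventually_mem_isCompact _ fun s hs => ?_
  obtain ⟨K, hK⟩ := hs 1 one_pos
  have hb : ∀ i : Fin 2, ∃ R, ∀ k ≥ K, |(s k).1 i| ≤ R := by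
    intro i
    refine ⟨4 * (|staircase ((s K).1 i)| + 1) + 4, fun k hk => ?_⟩
    have h1 := (edist_staircase_le_rdist hlam hpos hone i (s k) (s K)).trans_lt
      (hK k hk K le_rfl)
    rw [edist_dist, ENNReal.ofReal_lt_one, Real.dist_eq] at h1
    have h2 := abs_sub_abs_le_abs_sub (staircase ((s k).1 i)) (staircase ((s K).1 i))
    linarith [abs_le_staircase ((s k).1 i)]
  obtain ⟨R₀, h₀⟩ := hb 0
  obtain ⟨R₁, h₁⟩ := hb 1
  refine ⟨Metric.closedBall 0 (R₀ + R₁) ×ˢ univ,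
    (isCompact_closedBall _ _).prod isCompact_univ, ?_⟩
  filter_upwards [eventually_ge_atTop K] with k hk
  refine ⟨?_, mem_univ _⟩
  rw [mem_closedBall_zero_iff, EuclideanSpace.norm_eq, Fin.sum_univ_two]
  have a0 := h₀ k hk
  have a1 := h₁ k hk
  have b0 := abs_nonneg ((s k).1 0)
  have b1 := abs_nonneg ((s k).1 1)
  refine Real.sqrt_le_iff.2 ⟨by linarith, ?_⟩
  rw [Real.norm_eq_abs, Real.norm_eq_abs]
  nlinarith

end

section

/-! ### The conformal factor -/

theorem one_sub_expNegInvGlue_pos (t : ℝ) : 0 < 1 - expNegInvGlue t := by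
  rcases le_or_gt t 0 with h | h
  · simp [expNegInvGlue.zero_of_nonpos h]
  · rw [expNegInvGlue, if_neg h.not_ge, sub_pos, Real.exp_lt_one_iff, neg_lt_zero]
    exact inv_pos.2 h

/-- This bound and the next come from `exp y ≥ 1 + y` at `y = -1/t` and `y = 1/t`. Together they
show that `1 - exp (-1/t)` decays exactly like `1/t`. -/
theorem one_sub_expNegInvGlue_le {t : ℝ} (ht : 0 < t) : 1 - expNegInvGlue t ≤ t⁻¹ := by
  rw [expNegInvGlue, if_neg ht.not_ge]
  linarith [Real.add_one_le_exp (-t⁻¹)]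

theorem le_one_sub_expNegInvGlue {t : ℝ} (ht : 0 < t) : (t + 1)⁻¹ ≤ 1 - expNegInvGlue t := by
  rw [expNegInvGlue, if_neg ht.not_ge, Real.exp_neg]
  have h1 := Real.add_one_le_exp t⁻¹
  have h2 : (Real.exp t⁻¹)⁻¹ ≤ (t⁻¹ + 1)⁻¹ := inv_anti₀ (by positivity) h1
  have h3 : (t⁻¹ + 1)⁻¹ = 1 - (t + 1)⁻¹ := by field_simp; ring
  linarith

/-- A conformal factor that is close to `1 / m` near the points `(m, 0)`, where `m` is a positive
integer, and equal to `1` away from them. -/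
def conformalFactor (x : Euc 2) : ℝ :=
  1 - expNegInvGlue (x 0) *
    Real.smoothTransition (2 - 128 * (Real.sin (Real.pi * x 0) ^ 2 + x 1 ^ 2))

theorem contDiff_conformalFactor : ContDiff ℝ ∞ conformalFactor := by
  have h : ∀ i : Fin 2, ContDiff ℝ ∞ (fun x : Euc 2 => x i) := fun i =>
    (EuclideanSpace.proj i : Euc 2 →L[ℝ] ℝ).contDiff
  exact contDiff_const.sub ((expNegInvGlue.contDiff.comp (h 0)).mul
    (Real.smoothTransition.contDiff.comp (contDiff_const.sub (contDiff_const.mul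
      (((Real.contDiff_sin.comp (contDiff_const.mul (h 0))).pow 2).add ((h 1).pow 2))))))

theorem conformalFactor_pos (x : Euc 2) : 0 < conformalFactor x := by
  have h := mul_le_of_le_one_right (expNegInvGlue.nonneg (x 0))
    (Real.smoothTransition.le_one (2 - 128 * (Real.sin (Real.pi * x 0) ^ 2 + x 1 ^ 2)))
  have h2 := one_sub_expNegInvGlue_pos (x 0)
  rw [conformalFactor]
  linarith

theorem conformalFactor_le_one (x : Euc 2) : conformalFactor x ≤ 1 :=
  sub_le_self _ (mul_nonneg (expNegInvGlue.nonneg _) (Real.smoothTransition.nonneg _))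

/-- The point `(m, 0)` of the plane. -/
def axisPoint (m : ℕ) : Euc 2 := !₂[(m : ℝ), 0]

theorem mem_ball_axisPoint {x : Euc 2} {m : ℕ} {r : ℝ} (hr : 0 < r) :
    x ∈ Metric.ball (axisPoint m) r ↔ (x 0 - m) ^ 2 + x 1 ^ 2 < r ^ 2 := by
  rw [Metric.mem_ball, EuclideanSpace.dist_eq, Fin.sum_univ_two, Real.sqrt_lt' hr]
  simp [Real.dist_eq, sq_abs, axisPoint]

theorem sin_pi_mul_sq_eq (t : ℝ) (m : ℤ) :
    Real.sin (Real.pi * t) ^ 2 = Real.sin (Real.pi * (t - m)) ^ 2 := by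
  rw [mul_sub, mul_comm _ (m : ℝ), Real.sin_sub_int_mul_pi, mul_pow]
  rcases Int.even_or_odd m with h | h <;> simp [h.neg_one_zpow]

/-- The squared sine places a bump at every integer point of the axis, and `expNegInvGlue` switches
off the half-plane `x 0 ≤ 0`; elsewhere the nearest integer is a natural number. -/
theorem conformalFactor_eq_one {x : Euc 2}
    (hx : ∀ m : ℕ, x ∉ Metric.ball (axisPoint m) (1 / 8)) : conformalFactor x = 1 := by
  rcases le_or_gt (x 0) 0 with h | h
  · simp [conformalFactor, expNegInvGlue.zero_of_nonpos h]
  · obtain ⟨m, hm⟩ := Int.eq_ofNat_of_zero_le (a := round (x 0)) (by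
      rw [round_eq]
      exact Int.floor_nonneg.2 (by linarith))
    have hx' := hx m
    rw [mem_ball_axisPoint (by norm_num), not_lt] at hx'
    have h1 := abs_sub_round (x 0)
    rw [hm, Int.cast_natCast] at h1
    have h2 : Real.sin (Real.pi * x 0) ^ 2 ≥ 4 * (x 0 - m) ^ 2 := by
      rw [sin_pi_mul_sq_eq (x 0) m, Int.cast_natCast, ← sq_abs]
      have h3 : |Real.pi * (x 0 - m)| ≤ Real.pi / 2 := by
        rw [abs_mul, abs_of_pos Real.pi_pos]
        nlinarith [Real.pi_pos]
      have h4 := Real.mul_abs_le_abs_sin h3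
      have h5 : 2 / Real.pi * |Real.pi * (x 0 - m)| = 2 * |x 0 - m| := by
        rw [abs_mul, abs_of_pos Real.pi_pos]
        field_simp
      rw [h5] at h4
      calc 4 * (x 0 - m) ^ 2 = (2 * |x 0 - m|) ^ 2 := by rw [mul_pow, sq_abs]; norm_num
        _ ≤ _ := pow_le_pow_left₀ (by positivity) h4 2
    -- Outside the ball, `sin² + x₁²` is at least `(1/8)² = 1/64`, which makes `2 - 128 (sin² +
    -- x₁²)` nonpositive.
    rw [conformalFactor, Real.smoothTransition.zero_of_nonpos, mul_zero, sub_zero]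
    nlinarith [sq_nonneg (x 0 - m)]

/-- The radius `1/40` works because `π² ≤ 10` gives `sin² + x₁² ≤ 10/1600 < 1/128`, so the
transition function has already reached one. -/
theorem conformalFactor_of_mem_ball {x : Euc 2} {m : ℕ}
    (hx : x ∈ Metric.ball (axisPoint m) (1 / 40)) :
    conformalFactor x = 1 - expNegInvGlue (x 0) := by
  rw [mem_ball_axisPoint (by norm_num)] at hx
  rw [conformalFactor, Real.smoothTransition.one_of_one_le, mul_one]
  have h1 : Real.sin (Real.pi * x 0) ^ 2 ≤ 10 * (x 0 - m) ^ 2 := by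
    have h2 := sin_pi_mul_sq_eq (x 0) m
    rw [Int.cast_natCast] at h2
    rw [h2]
    have h3 : Real.sin (Real.pi * (x 0 - m)) ^ 2 ≤ (Real.pi * (x 0 - m)) ^ 2 :=
      sq_le_sq.2 Real.abs_sin_le_abs
    have h4 : Real.pi ^ 2 ≤ 10 := by nlinarith [Real.pi_lt_d2, Real.pi_pos]
    nlinarith [sq_nonneg (x 0 - m)]
  nlinarith [sq_nonneg (x 1)]

theorem conformalFactor_bounds {x : Euc 2} {m : ℕ} (hm : 1 ≤ m)
    (hx : x ∈ Metric.ball (axisPoint m) (1 / 40)) :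
    ((m : ℝ) + 2)⁻¹ ≤ conformalFactor x ∧ conformalFactor x ≤ 2 / m := by
  rw [conformalFactor_of_mem_ball hx]
  rw [mem_ball_axisPoint (by norm_num)] at hx
  have hm' : (1 : ℝ) ≤ m := by exact_mod_cast hm
  have h1 : |x 0 - m| < 1 / 40 :=
    abs_lt_of_sq_lt_sq (by nlinarith [sq_nonneg (x 1)]) (by norm_num)
  rw [abs_lt] at h1
  have h0 : 0 < x 0 := by linarith
  refine ⟨(inv_anti₀ (by linarith) (by linarith)).trans (le_one_sub_expNegInvGlue h0),
    (one_sub_expNegInvGlue_le h0).trans ?_⟩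
  rw [inv_eq_one_div, div_le_div_iff₀ h0 (by linarith)]
  linarith

/-! ### The test functions -/

theorem planeLaplacian_congr {u v : Euc 2 → ℝ} {x : Euc 2} (h : u =ᶠ[𝓝 x] v) :
    planeLaplacian u x = planeLaplacian v x := by
  refine Finset.sum_congr rfl fun i _ => ?_
  have h1 : (fun x => fderiv ℝ u x (EuclideanSpace.single i 1)) =ᶠ[𝓝 x]
      fun x => fderiv ℝ v x (EuclideanSpace.single i 1) := by
    filter_upwards [h.fderiv (𝕜 := ℝ)] with y hy
    rw [hy]
  rw [h1.fderiv_eq]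

theorem planeLaplacian_clm (L : Euc 2 →L[ℝ] ℝ) (x : Euc 2) : planeLaplacian L x = 0 := by
  simp [planeLaplacian]

theorem planeLaplacian_comp_sub_const (u : Euc 2 → ℝ) (c x : Euc 2) :
    planeLaplacian (fun x => u (x - c)) x = planeLaplacian u (x - c) := by
  simp only [planeLaplacian, fderiv_comp_sub]
  refine Finset.sum_congr rfl fun i _ => ?_
  rw [fderiv_comp_sub (f := fun x => fderiv ℝ u x (EuclideanSpace.single i 1))]

theorem continuous_planeLaplacian {u : Euc 2 → ℝ} (hu : ContDiff ℝ 2 u) :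
    Continuous (planeLaplacian u) := by
  refine continuous_finsetSum _ fun i _ => ?_
  have h : ContDiff ℝ 1 (fun x => fderiv ℝ u x (EuclideanSpace.single i 1)) :=
    (hu.fderiv_right (m := 1) (by norm_num)).clm_apply contDiff_const
  exact (h.continuous_fderiv (by norm_num)).clm_apply continuous_const

/-- A bump function around the origin of the plane. -/
def planeBump : ContDiffBump (0 : Euc 2) := ⟨1 / 4, 1 / 2, by norm_num, by norm_num⟩

/-- The first coordinate of the plane, cut off outside a neighbourhood of the origin. -/
def cutoffCoord (x : Euc 2) : ℝ := planeBump x * x 0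

theorem contDiff_cutoffCoord : ContDiff ℝ ∞ cutoffCoord :=
  planeBump.contDiff.mul (EuclideanSpace.proj 0 : Euc 2 →L[ℝ] ℝ).contDiff

theorem cutoffCoord_eventuallyEq {x : Euc 2} (hx : x ∈ Metric.ball 0 (1 / 4)) :
    cutoffCoord =ᶠ[𝓝 x] (EuclideanSpace.proj 0 : Euc 2 →L[ℝ] ℝ) := by
  filter_upwards [Metric.isOpen_ball.mem_nhds hx] with y hy
  rw [cutoffCoord, planeBump.one_of_mem_closedBall (Metric.ball_subset_closedBall hy), one_mul]
  rfl

theorem cutoffCoord_eq_zero {x : Euc 2} (hx : x ∉ Metric.closedBall 0 (1 / 2)) :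
    cutoffCoord x = 0 := by
  rw [mem_closedBall_zero_iff, not_le] at hx
  rw [cutoffCoord, planeBump.zero_of_le_dist (by rw [dist_zero_right]; exact hx.le), zero_mul]

theorem planeLaplacian_cutoffCoord_eq_zero {x : Euc 2}
    (hx : x ∉ Metric.closedBall (0 : Euc 2) (1 / 2)) : planeLaplacian cutoffCoord x = 0 := by
  rw [planeLaplacian_congr (v := (0 : Euc 2 →L[ℝ] ℝ)), planeLaplacian_clm]
  filter_upwards [Metric.isClosed_closedBall.isOpen_compl.mem_nhds hx] with y hy
  exact cutoffCoord_eq_zero hy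

theorem hasCompactSupport_cutoffCoord : HasCompactSupport cutoffCoord :=
  HasCompactSupport.intro (isCompact_closedBall 0 (1 / 2)) fun _ => cutoffCoord_eq_zero

/-- The cut off coordinate function around the point `(k, 0)`. -/
def testFunction (k : ℕ) (x : Euc 2) : ℝ := cutoffCoord (x - axisPoint k)

theorem contDiff_testFunction (k : ℕ) : ContDiff ℝ ∞ (testFunction k) :=
  contDiff_cutoffCoord.comp (contDiff_id.sub contDiff_const)

theorem hasCompactSupport_testFunction (k : ℕ) : HasCompactSupport (testFunction k) :=
  hasCompactSupport_cutoffCoord.comp_homeomorph (Homeomorph.subRight (axisPoint k))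

theorem sub_mem_closedBall_zero {x c : Euc 2} {r : ℝ} :
    x - c ∈ Metric.closedBall 0 r ↔ x ∈ Metric.closedBall c r := by
  rw [mem_closedBall_zero_iff, mem_closedBall_iff_norm]

theorem sub_mem_ball_zero {x c : Euc 2} {r : ℝ} :
    x - c ∈ Metric.ball 0 r ↔ x ∈ Metric.ball c r := by
  rw [mem_ball_zero_iff, mem_ball_iff_norm]

theorem one_le_dist_axisPoint {m k : ℕ} (h : m ≠ k) : 1 ≤ dist (axisPoint m) (axisPoint k) := by
  by_contra! hlt
  have h1 : axisPoint m ∈ Metric.ball (axisPoint k) 1 := hlt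
  rw [mem_ball_axisPoint one_pos] at h1
  have h2 : ((m : ℤ) - k) ^ 2 < 1 := by
    have : ((m : ℝ) - k) ^ 2 < 1 := by simpa [axisPoint] using h1
    exact_mod_cast this
  have h3 : (m : ℤ) - k ≠ 0 := by omega
  have : 0 < ((m : ℤ) - k) ^ 2 := by positivity
  omega

/-- The test functions are harmonic wherever the conformal factor is not `1`. -/
theorem planeLaplacian_testFunction_eq_zero_or (k : ℕ) (x : Euc 2) :
    planeLaplacian (testFunction k) x = 0 ∨ conformalFactor x = 1 := by
  by_cases hx : ∀ m : ℕ, x ∉ Metric.ball (axisPoint m) (1 / 8)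
  · exact Or.inr (conformalFactor_eq_one hx)
  · left
    push Not at hx
    obtain ⟨m, hm⟩ := hx
    change planeLaplacian (fun x => cutoffCoord (x - axisPoint k)) x = 0
    rw [planeLaplacian_comp_sub_const]
    -- At its own spike the test function is linear on the larger ball of radius `1/4`. At any other
    -- spike `1/8 + 1/2 < 1` keeps the point outside the support.
    rcases eq_or_ne m k with rfl | hmk
    · rw [planeLaplacian_congr (cutoffCoord_eventuallyEq (sub_mem_ball_zero.2
        (Metric.ball_subset_ball (by norm_num) hm))), planeLaplacian_clm]
    · refine planeLaplacian_cutoffCoord_eq_zero fun h => ?_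
      rw [sub_mem_closedBall_zero, Metric.mem_closedBall] at h
      rw [Metric.mem_ball, dist_comm] at hm
      linarith [one_le_dist_axisPoint hmk, dist_triangle (axisPoint m) x (axisPoint k)]

theorem fderiv_testFunction {k : ℕ} {x : Euc 2} (hx : x ∈ Metric.ball (axisPoint k) (1 / 4)) :
    fderiv ℝ (testFunction k) x = (EuclideanSpace.proj 0 : Euc 2 →L[ℝ] ℝ) := by
  change fderiv ℝ (fun x => cutoffCoord (x - axisPoint k)) x = _
  rw [fderiv_comp_sub, (cutoffCoord_eventuallyEq (sub_mem_ball_zero.2 hx)).fderiv_eq]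
  exact ContinuousLinearMap.fderiv _

/-! ### Norm estimates for the test functions in the spiked metric -/

variable {d : ℕ}

/-- The metric on the product of the plane and the flat torus that violates the gradient
estimate. -/
def spikedMetric (d : ℕ) : ContMDiffRiemannianMetric ((𝓡 2).prod (𝓡 d)) ∞ (Euc 2 × Euc d)
    (fun z : Euc 2 × FlatTorus d => TangentSpace ((𝓡 2).prod (𝓡 d)) z) :=
  conformalMetric d contDiff_conformalFactor conformalFactor_pos

/-- The factor `lam⁻²` matters only where it multiplies zero, so the result is a translate of one
fixed function. -/
theorem laplacian_testFunction (k : ℕ) (z : Euc 2 × FlatTorus d) :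
    laplacian (spikedMetric d) (stdBasis d) (fun z => testFunction k z.1) z =
      planeLaplacian cutoffCoord (z.1 - axisPoint k) := by
  have h2 : ContDiff ℝ 2 (testFunction k) :=
    contDiff_infty.1 (contDiff_testFunction k) 2
  rw [spikedMetric, laplacian_conformalMetric _ _ h2, ← planeLaplacian_comp_sub_const]
  change _ * planeLaplacian (testFunction k) z.1 = planeLaplacian (testFunction k) z.1
  rcases planeLaplacian_testFunction_eq_zero_or k z.1 with h | h <;> simp [h]

theorem exists_bound_lpNorm_testFunction (d : ℕ) {p : ℝ} (hp : 0 < p) : ∃ A : ℝ≥0, ∀ k,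
    lpNorm (spikedMetric d) (stdBasis d) p
      (fun z : Euc 2 × FlatTorus d => testFunction k z.1) ≤ A ∧
    lpNorm (spikedMetric d) (stdBasis d) p
      (laplacian (spikedMetric d) (stdBasis d)
        (fun z : Euc 2 × FlatTorus d => testFunction k z.1)) ≤ A := by
  obtain ⟨C₁, hC₁⟩ := contDiff_cutoffCoord.continuous.bounded_above_of_compact_support
    hasCompactSupport_cutoffCoord
  have h2 : ContDiff ℝ 2 cutoffCoord := contDiff_infty.1 contDiff_cutoffCoord 2
  obtain ⟨C₂, hC₂⟩ := (continuous_planeLaplacian h2).bounded_above_of_compact_support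
    (HasCompactSupport.intro (isCompact_closedBall 0 (1 / 2))
      fun _ => planeLaplacian_cutoffCoord_eq_zero)
  have hv : volume (Metric.closedBall (0 : Euc 2) (1 / 2)) ^ (1 / p) ≠ ⊤ :=
    ENNReal.rpow_ne_top_of_nonneg (by positivity) measure_closedBall_lt_top.ne
  have hb : ∀ C, C ≤ max C₁ C₂ → ENNReal.ofReal C *
      volume (Metric.closedBall (0 : Euc 2) (1 / 2)) ^ (1 / p) ≤
      ((ENNReal.ofReal (max C₁ C₂) *
        volume (Metric.closedBall (0 : Euc 2) (1 / 2)) ^ (1 / p)).toNNReal : ℝ≥0∞) := by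
    intro C hC
    rw [ENNReal.coe_toNNReal (ENNReal.mul_ne_top ENNReal.ofReal_ne_top hv)]
    gcongr
  refine ⟨_, fun k => ⟨le_trans ?_ (hb C₁ (le_max_left _ _)),
    le_trans ?_ (hb C₂ (le_max_right _ _))⟩⟩
  · exact lpNorm_conformalMetric_le _ _ conformalFactor_le_one hp (axisPoint k)
      (fun z => hC₁ _) fun z hz => cutoffCoord_eq_zero (by rwa [sub_mem_closedBall_zero])
  · refine lpNorm_conformalMetric_le _ _ conformalFactor_le_one hp (axisPoint k)
      (fun z => ?_) fun z hz => ?_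
    · rw [laplacian_testFunction]
      exact hC₂ _
    · rw [laplacian_testFunction]
      exact planeLaplacian_cutoffCoord_eq_zero (by rwa [sub_mem_closedBall_zero])

theorem le_gradNorm_testFunction {k : ℕ} (hk : 1 ≤ k) (z : Euc 2 × FlatTorus d)
    (hz : z.1 ∈ Metric.ball (axisPoint k) (1 / 40)) :
    (k : ℝ) / 2 ≤
      gradNorm (spikedMetric d) (stdBasis d) (fun z => testFunction k z.1) z := by
  rw [spikedMetric, gradNorm_conformalMetric _ _
    ((contDiff_testFunction k).differentiable (by simp)),
    fderiv_testFunction (Metric.ball_subset_ball (by norm_num) hz)]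
  have h := (conformalFactor_bounds hk hz).2
  have hk' : (0 : ℝ) < k := by exact_mod_cast hk
  have h1 : (k : ℝ) / 2 ≤ (conformalFactor z.1)⁻¹ := by
    rw [← inv_div]
    exact inv_anti₀ (conformalFactor_pos _) h
  refine Real.le_sqrt_of_sq_le ?_
  simp only [Fin.sum_univ_two, PiLp.proj_apply]
  simpa using pow_le_pow_left₀ (by positivity) h1 2

theorem exists_lt_lpNorm_gradNorm_testFunction (d : ℕ) {p : ℝ} (hp : 2 < p) (B : ℝ≥0) :
    ∃ k, (B : ℝ≥0∞) < lpNorm (spikedMetric d) (stdBasis d) p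
      (gradNorm (spikedMetric d) (stdBasis d)
        (fun z : Euc 2 × FlatTorus d => testFunction k z.1)) := by
  have hp0 : 0 < p := by linarith
  have hpos : 0 < volume (Metric.ball (0 : Euc 2) (1 / 40)) *
      volume (FlatTorus.chart (FlatTorus.corner (fun _ => 0 : FlatTorus d))).target :=
    ENNReal.mul_pos (Metric.measure_ball_pos _ _ (by norm_num)).ne' (volume_chart_target_pos _).ne'
  -- A positive real below the volume moves the remaining computation from extended to ordinary
  -- reals.
  obtain ⟨c, hc, hc'⟩ := ENNReal.lt_iff_exists_nnreal_btwn.1 hpos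
  have hc0 : (0 : ℝ) < c := by exact_mod_cast hc
  have key : ∀ k : ℕ, 1 ≤ k →
      ENNReal.ofReal ((c / 9 : ℝ) ^ (1 / p) / 2 * (k : ℝ) ^ (1 - 2 / p)) ≤
      lpNorm (spikedMetric d) (stdBasis d) p (gradNorm (spikedMetric d) (stdBasis d)
        (fun z : Euc 2 × FlatTorus d => testFunction k z.1)) := by
    intro k hk
    have hk' : (1 : ℝ) ≤ k := by exact_mod_cast hk
    have hk0 : (0 : ℝ) < k := by linarith
    have h1 := le_volumeMeasure_conformalMetric contDiff_conformalFactor conformalFactor_pos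
      (fun _ => 0 : FlatTorus d) (Metric.isOpen_ball.measurableSet) (by positivity)
      fun x hx => (conformalFactor_bounds hk hx).1
    have h2 := le_lpNorm_conformalMetric contDiff_conformalFactor conformalFactor_pos hp0
      (Metric.isOpen_ball.measurableSet) (by positivity)
      fun z hz => le_gradNorm_testFunction (d := d) hk z hz
    refine le_trans ?_ h2
    rw [Measure.addHaar_ball_center] at h1
    have h3 : ENNReal.ofReal (c / 9 * ((k : ℝ) ^ 2)⁻¹) ≤
        volumeMeasure (conformalMetric d contDiff_conformalFactor conformalFactor_pos) (stdBasis d)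
          (Metric.ball (axisPoint k) (1 / 40) ×ˢ univ) := by
      refine le_trans ?_ h1
      calc ENNReal.ofReal (c / 9 * ((k : ℝ) ^ 2)⁻¹)
          ≤ ENNReal.ofReal ((((k : ℝ) + 2)⁻¹) ^ 2 * c) := by
            refine ENNReal.ofReal_le_ofReal ?_
            -- From `k + 2 ≤ 3k` for `k ≥ 1`; its square is the source of the factor `1/9`.
            have h4 : (3 * (k : ℝ))⁻¹ ≤ ((k : ℝ) + 2)⁻¹ :=
              inv_anti₀ (by positivity) (by linarith)
            have h5 := pow_le_pow_left₀ (by positivity) h4 2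
            calc c / 9 * ((k : ℝ) ^ 2)⁻¹ = ((3 * (k : ℝ))⁻¹) ^ 2 * c := by
                  field_simp
                  norm_num
              _ ≤ _ := by gcongr
        _ = ENNReal.ofReal ((((k : ℝ) + 2)⁻¹) ^ 2) * c := by
            rw [ENNReal.ofReal_mul (by positivity), ENNReal.ofReal_coe_nnreal]
        _ ≤ _ := by gcongr
    calc _ = ENNReal.ofReal (k / 2) * ENNReal.ofReal (c / 9 * ((k : ℝ) ^ 2)⁻¹) ^ (1 / p) := by
          rw [ENNReal.ofReal_rpow_of_pos (by positivity), ← ENNReal.ofReal_mul (by positivity)]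
          congr 1
          rw [Real.mul_rpow (by positivity) (by positivity), ← Real.rpow_natCast, ← Real.rpow_neg
            hk0.le, ← Real.rpow_mul hk0.le, Real.rpow_sub hk0, Real.rpow_one,
            show -((2 : ℕ) : ℝ) * (1 / p) = -(2 / p) by push_cast; ring, Real.rpow_neg hk0.le]
          ring
      _ ≤ _ := by gcongr
  have ht : Tendsto (fun k : ℕ => (c / 9 : ℝ) ^ (1 / p) / 2 * (k : ℝ) ^ (1 - 2 / p)) atTop atTop := by
    refine Tendsto.const_mul_atTop (by positivity) ((tendsto_rpow_atTop ?_).comp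
      tendsto_natCast_atTop_atTop)
    -- The exponent `1 - 2/p` is positive exactly when `p > 2`.
    rw [sub_pos, div_lt_one hp0]
    exact hp
  obtain ⟨k, hk1, hk2⟩ := ((eventually_ge_atTop 1).and (ht.eventually_gt_atTop B)).exists
  refine ⟨k, lt_of_lt_of_le ?_ (key k hk1)⟩
  rw [← ENNReal.ofReal_coe_nnreal]
  exact (ENNReal.ofReal_lt_ofReal_iff_of_nonneg B.2).2 hk2

theorem not_gradientEstimate_spikedMetric (d : ℕ) {p : ℝ} (hp : 2 < p) :
    ¬ GradientEstimate (spikedMetric d) (stdBasis d) p := by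
  rintro ⟨C, hC⟩
  obtain ⟨A, hA⟩ := exists_bound_lpNorm_testFunction d (p := p) (by linarith)
  obtain ⟨k, hk⟩ := exists_lt_lpNorm_gradNorm_testFunction d hp (C * (A + A))
  refine (hk.trans_le (hC _ ?_ ?_)).not_ge ?_
  · exact (contDiff_testFunction k).contMDiff.comp contMDiff_fst
  · refine HasCompactSupport.intro
      ((hasCompactSupport_testFunction k).isCompact.prod isCompact_univ) fun z hz => ?_
    exact image_eq_zero_of_notMem_tsupport fun h => hz ⟨h, mem_univ _⟩
  · push_cast
    gcongr
    exacts [(hA k).1, (hA k).2]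

end

end RiemannianLp

end

open RiemannianLp in
theorem theoremC (n : ℕ) (hn : 2 ≤ n) (p : ℝ) (hp : 2 < p) :
    ∃ (lam : Euc 2 → ℝ) (N : Type) (_ : TopologicalSpace N) (_ : ChartedSpace (Euc (n - 2)) N)
      (_ : IsManifold (𝓡 (n - 2)) ∞ N) (_ : MeasurableSpace N) (_ : BorelSpace N)
      (h : ContMDiffRiemannianMetric (𝓡 (n - 2)) ∞ (Euc (n - 2))
        (fun y : N => TangentSpace (𝓡 (n - 2)) y))
      (g : ContMDiffRiemannianMetric ((𝓡 2).prod (𝓡 (n - 2))) ∞ (Euc 2 × Euc (n - 2))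
        (fun z : Euc 2 × N => TangentSpace ((𝓡 2).prod (𝓡 (n - 2))) z))
      (u : ℕ → Euc 2 → ℝ),
      -- the conformal factor
      ContDiff ℝ ∞ lam ∧ (∀ x, 0 < lam x ∧ lam x ≤ 1) ∧
      (∀ x : Euc 2, (∀ m : ℕ, x ∉ Metric.ball (!₂[(m : ℝ), 0] : Euc 2) (1 / 8)) → lam x = 1) ∧
      -- the closed manifold, and the product metric
      T2Space N ∧ CompactSpace N ∧ ConnectedSpace N ∧ IsConformalProduct lam h g ∧
      -- completeness, and failure of the gradient estimate
      IsComplete g ∧ ¬ GradientEstimate g (stdBasis (n - 2)) p ∧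
      -- the test functions
      (∀ k, ContDiff ℝ ∞ (u k) ∧ HasCompactSupport (u k)) ∧
      (∃ A : ℝ≥0, ∀ k,
        lpNorm g (stdBasis (n - 2)) p (fun z : Euc 2 × N => u k z.1) ≤ A ∧
        lpNorm g (stdBasis (n - 2)) p
          (laplacian g (stdBasis (n - 2)) (fun z : Euc 2 × N => u k z.1)) ≤ A) ∧
      (∀ B : ℝ≥0, ∃ k, (B : ℝ≥0∞) <
        lpNorm g (stdBasis (n - 2)) p
          (gradNorm g (stdBasis (n - 2)) (fun z : Euc 2 × N => u k z.1))) :=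
  ⟨conformalFactor, FlatTorus (n - 2), inferInstance, inferInstance, inferInstance, inferInstance,
    inferInstance, flatMetric (n - 2), spikedMetric (n - 2), testFunction,
    contDiff_conformalFactor, fun x => ⟨conformalFactor_pos x, conformalFactor_le_one x⟩,
    fun _ hx => conformalFactor_eq_one hx, inferInstance, inferInstance, inferInstance,
    isConformalProduct_conformalMetric _ _,
    isComplete_conformalMetric _ _ fun _ hx => conformalFactor_eq_one hx,
    not_gradientEstimate_spikedMetric _ hp,
    fun k => ⟨contDiff_testFunction k, hasCompactSupport_testFunction k⟩,
    exists_bound_lpNorm_testFunction _ (by linarith),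
    exists_lt_lpNorm_gradNorm_testFunction _ hp⟩
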